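/- **Setting.** Let $\mathcal X$ (states) and $\mathcal A$ (actions) be standard Borel spaces (for instance Borel subsets of Euclidean spaces), $P$ a probability kernel from $\mathcal X\times\mathcal A$ to $\mathcal X$, $r:\mathcal X\times\mathcal A\to\mathbb R$ bounded and measurable, $\gamma\in(0,1)$, and $\pi^{\mathrm{ref}}$ a reference policy; a policy is a probability kernel from $\mathcal X$ to $\mathcal A$. For a policy $\pi$ let $(X_t,A_t)_{t\ge0}$ be the induced Markov chain, with $X_{t+1}\sim P_{X_t,A_t}$ and $A_{t+1}\sim\pi_{X_{t+1}}$. Write $\mathrm{KL}_\pi(x)=\mathrm{KL}(\pi_x\,\|\,\pi^{\mathrm{ref}}_x)$ and, conditionally on $X_0=x,A_0=a$, $$\zeta^\pi_{x,a}=\mathrm{Law}\Big(\sum_{t\ge0}\gamma^t r(X_t,A_t)\Big),\qquad \varsigma^{\tau,\pi}_{x,a}=\mathrm{Law}\Big(r(X_0,A_0)+\sum_{t\ge1}\gamma^t\big(r(X_t,A_t)-\tau\,\mathrm{KL}_\pi(X_t)\big)\Big).$$ Let $q^\pi$ be the mean of $\zeta^\pi$, and for a kernel $\varsigma$ from $\mathcal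 X\times\mathcal A$ to $\mathbb R$ let $(\mathcal Q\varsigma)(x,a)=\int z\,d\varsigma_{x,a}(z)$. For $\tau>0$ put $(\mathcal V_\tau q)(x)=\tau\log\int e^{q(x,a)/\tau}\,d\pi^{\mathrm{ref}}_x(a)$, let $\mathcal B_\tau q$ be the policy with density $e^{(q(x,a)-(\mathcal V_\tau q)(x))/\tau}$ with respect to $\pi^{\mathrm{ref}}_x$, let $q^\star_\tau$ be the unique bounded measurable solution of $q(x,a)=r(x,a)+\gamma\int \mathcal V_\tau q\,dP_{x,a}$, and let $\pi^{\tau,\star}=\mathcal B_\tau q^\star_\tau$. Let $q^\star_{\mathrm{ref}}$ be the unique bounded measurable solution of $q(x,a)=r(x,a)+\gamma\int \operatorname{ess\,sup}_{\pi^{\mathrm{ref}}_{x'}}q(x',\cdot)\,dP_{x,a}(x')$. A policy $\pi$ is $\epsilon$-reference-optimal if $q^\pi\ge q^\star_{\mathrm{ref}}-\epsilon$ everywhere. The soft distributional optimality operator $\mathcal T_\tau$ sends $\varsigma$ to the kernel whose value at $(x,a)$ is the law of $r(x,a)+\gamma Z-\gamma\tau\,\mathrm{KL}_{\pi}(X')$,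 where $\pi=\mathcal B_\tau\mathcal Q\varsigma$, $X'\sim P_{x,a}$, $A'\sim\pi_{X'}$ and $Z\sim\varsigma_{X',A'}$. For $p,p'\in[1,\infty)$ and a probability measure $\omega$ on $\mathcal X\times\mathcal A$ let $\bar w_{p,p'}(\lambda,\lambda')=\big(\int w_p(\lambda_y,\lambda'_y)^{p'}\,d\omega(y)\big)^{1/p'}$, with $w_p$ the $p$-Wasserstein distance on $\mathbb R$. **Theorem.** Assume that there is a constant $p_{\min}>0$ with $$\inf_{\tau>0}\inf_{x}\pi^{\mathrm{ref}}_x\big(\{a: q^\star_\tau(x,a)=\operatorname{ess\,sup}_{\pi^{\mathrm{ref}}_x}q^\star_\tau(x,\cdot)\}\big)\ge p_{\min}.$$ Let $p,p'\in[1,\infty)$ and let $\omega$ be a probability measure on $\mathcal X\times\mathcal A$. For all $\epsilon,\delta>0$ there is $\tau>0$ such that $\bar w_{p,p'}(\varsigma^{\tau,\pi^{\tau,\star}},\zeta^{\pi^{\tau,\star}})\le\delta/2$ and $\pi^{\tau,\star}$ is $\epsilon/2$-reference-optimal. Moreover, with this same $\tau$, for every probability kernel $\varsigma$ from $\mathcal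 X\times\mathcal A$ to $\mathbb R$ with $\sup_{x,a}\int|z|^p\,d\varsigma_{x,a}(z)<\infty$ there is $N\in\mathbb N$ such that, for all $n\ge N$, the iterates $\varsigma^0=\mathcal T_\tau\varsigma$, $\varsigma^{n+1}=\mathcal T_\tau\varsigma^n$ satisfy $\bar w_{p,p'}(\varsigma^n,\zeta^{\pi^{\tau,\star}})\le\delta$, and $\mathcal B_\tau\mathcal Q\varsigma^n$ is $\epsilon$-reference-optimal. -/

import Mathlib

open MeasureTheory ProbabilityTheory Set Function
open scoped ENNReal

noncomputable section

namespace DERL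

universe u v

variable {S : Type u} {A : Type v} [MeasurableSpace S] [MeasurableSpace A]

/-- A discounted Markov decision process with state space `S` and action space `A`: a transition
probability kernel `P`, a bounded measurable reward `r`, and a discount factor `γ ∈ (0, 1)`. -/
structure MDP (S : Type u) (A : Type v) [MeasurableSpace S] [MeasurableSpace A] where
  P : Kernel (S × A) S
  markov_P : IsMarkovKernel P
  r : S × A → ℝ
  measurable_r : Measurable r
  bounded_r : ∃ C : ℝ, ∀ y, |r y| ≤ C
  γ : ℝ
  γ_pos : 0 < γ
  γ_lt_one : γ < 1

instance (M : MDP S A) : IsMarkovKernel M.P := M.markov_P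

/-- `q ∈ M_b(S × A)`: bounded and measurable. -/
def IsBddMeas (q : S × A → ℝ) : Prop :=
  Measurable q ∧ ∃ C : ℝ, ∀ y, |q y| ≤ C

/-! ### Wasserstein metrics -/

/-- The `p`-Wasserstein distance of two measures on `ℝ`, as an infimum over couplings,
with values in `[0, ∞]`. -/
def wass (p : ℝ) (μ ν : Measure ℝ) : ℝ≥0∞ :=
  (⨅ (c : Measure (ℝ × ℝ)) (_ : c.fst = μ ∧ c.snd = ν),
    ∫⁻ z, edist z.1 z.2 ^ p ∂c) ^ (1 / p)

/-- `(∫ w_p(κ_y, κ'_y) ^ q dω(y)) ^ (1 / q)`, with values in `[0, ∞]`. -/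
def muWass {Y : Type*} [MeasurableSpace Y] (p q : ℝ) (ω : Measure Y) (κ κ' : Kernel Y ℝ) : ℝ≥0∞ :=
  (∫⁻ y, wass p (κ y) (κ' y) ^ q ∂ω) ^ (1 / q)

/-- Bounded `p`-th moments: `sup_y ∫ |z| ^ p dκ_y(z) < ∞`. -/
def HasBoundedMoments {Y : Type*} [MeasurableSpace Y] (p : ℝ) (κ : Kernel Y ℝ) : Prop :=
  (⨆ y, ∫⁻ z, ‖z‖ₑ ^ p ∂(κ y)) < ∞

/-- The mean function `(Q ζ)(y) = E_{Z ∼ ζ_y}[Z]`. -/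
def meanQ (ζ : Kernel (S × A) ℝ) (y : S × A) : ℝ := ∫ z, z ∂(ζ y)

/-! ### Trajectories and return distributions -/

/-- The state-action transition kernel of a policy `π`: from `(x, a)`, draw `x' ∼ P_{x,a}` and
then `a' ∼ π_{x'}`. -/
def step (M : MDP S A) (π : Kernel S A) : Kernel (S × A) (S × A) :=
  M.P ⊗ₖ π.prodMkLeft (S × A)

instance (M : MDP S A) (π : Kernel S A) [IsMarkovKernel π] : IsMarkovKernel (step M π) := by
  unfold step; infer_instance

/-- The law of the trajectory `(X_t, A_t)_{t ≥ 0}` generated by the policy `π`, conditionally on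
`(X_0, A_0) = (x, a)`, as a kernel in `(x, a)`. -/
def trajectory (M : MDP S A) (π : Kernel S A) [IsMarkovKernel π] :
    Kernel (S × A) (ℕ → S × A) :=
  (Kernel.traj (X := fun _ : ℕ => S × A)
    (fun n => (step M π).comap (fun h => h ⟨n, Finset.mem_Iic.2 le_rfl⟩)
      (measurable_pi_apply _)) 0).comap
    (fun y _ => y) (measurable_pi_lambda _ fun _ => measurable_id)

open Classical in
/-- The return distribution function `ζ^π_{x,a}`: the law of `∑_{t ≥ 0} γ^t r(X_t, A_t)` under `π`
given `(X_0, A_0) = (x, a)`. (The value `0` for a kernel that is not a policy, i.e. not Markov,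
is a convention.) -/
def returnDist (M : MDP S A) (π : Kernel S A) : Kernel (S × A) ℝ :=
  if _h : IsMarkovKernel π then
    (trajectory M π).map fun w => ∑' t : ℕ, M.γ ^ t * M.r (w t)
  else 0

/-- The function `x ↦ KL(π_x ‖ πref_x)`. -/
def klFn (π πref : Kernel S A) (x : S) : ℝ :=
  (InformationTheory.klDiv (π x) (πref x)).toReal

open Classical in
/-- The soft return distribution function of `π` at temperature `τ`: the law of
`r(X_0, A_0) + ∑_{t ≥ 1} γ^t (r(X_t, A_t) - τ KL(π_{X_t} ‖ πref_{X_t}))` under `π`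
given `(X_0, A_0) = (x, a)`. -/
def softReturnDist (M : MDP S A) (πref : Kernel S A) (τ : ℝ) (π : Kernel S A) :
    Kernel (S × A) ℝ :=
  if _h : IsMarkovKernel π then
    (trajectory M π).map fun w => M.r (w 0) +
      ∑' t : ℕ, M.γ ^ (t + 1) * (M.r (w (t + 1)) - τ * klFn π πref (w (t + 1)).1)
  else 0

/-- The action-value function `q^π`, the mean of `ζ^π`. -/
def qValue (M : MDP S A) (π : Kernel S A) : S × A → ℝ := meanQ (returnDist M π)

/-! ### Entropy-regularized reinforcement learning -/

/-- `(V_τ q)(x) = τ log ∫ exp(q(x, a) / τ) dπref_x(a)`. -/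
def softValue (πref : Kernel S A) (τ : ℝ) (q : S × A → ℝ) (x : S) : ℝ :=
  τ * Real.log (∫ a, Real.exp (q (x, a) / τ) ∂(πref x))

/-- The Boltzmann-Gibbs policy of `q` at temperature `τ`: its density with respect to `πref_x`
is `a ↦ exp((q(x, a) - (V_τ q)(x)) / τ)`. -/
def boltzmann (πref : Kernel S A) [IsSFiniteKernel πref] (τ : ℝ) (q : S × A → ℝ) : Kernel S A :=
  πref.withDensity fun x a => ENNReal.ofReal (Real.exp ((q (x, a) - softValue πref τ q x) / τ))

/-- The soft Bellman optimality operator. -/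
def softBellmanOpt (M : MDP S A) (πref : Kernel S A) (τ : ℝ) (q : S × A → ℝ) (y : S × A) : ℝ :=
  M.r y + M.γ * ∫ x', softValue πref τ q x' ∂(M.P y)

/-- `q*_τ`: the unique bounded measurable fixed point of the soft Bellman optimality operator. -/
def qSoftStar (M : MDP S A) (πref : Kernel S A) (τ : ℝ) : S × A → ℝ :=
  Classical.epsilon fun q => IsBddMeas q ∧ softBellmanOpt M πref τ q = q

/-- `π^{τ,*}`, the Boltzmann-Gibbs policy of `q*_τ`. -/
def piStar (M : MDP S A) (πref : Kernel S A) [IsSFiniteKernel πref] (τ : ℝ) : Kernel S A :=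
  boltzmann πref τ (qSoftStar M πref τ)

/-! ### Reference-optimality -/

/-- The Bellman reference-optimality operator. -/
def bellmanRef (M : MDP S A) (πref : Kernel S A) (q : S × A → ℝ) (y : S × A) : ℝ :=
  M.r y + M.γ * ∫ x', essSup (fun a' => q (x', a')) (πref x') ∂(M.P y)

/-- The reference-optimal action-value function: the unique bounded measurable fixed point of the
Bellman reference-optimality operator. -/
def qRefStar (M : MDP S A) (πref : Kernel S A) : S × A → ℝ :=
  Classical.epsilon fun q => IsBddMeas q ∧ bellmanRef M πref q = q

/-- `π` is a policy (a probability kernel) and `q^π ≥ q*_ref - ε` everywhere. -/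
def IsRefOptimal (M : MDP S A) (πref : Kernel S A) (ε : ℝ) (π : Kernel S A) : Prop :=
  IsMarkovKernel π ∧ ∀ y, qRefStar M πref y - ε ≤ qValue M π y

/-- The coverage assumption: some `pmin > 0` bounds from below, uniformly over `τ > 0` and `x`, the
`πref_x`-mass of the set of actions `a` with `q*_τ(x, a) = ess sup_{πref_x} q*_τ(x, ·)`. -/
def Coverage (M : MDP S A) (πref : Kernel S A) : Prop :=
  ∃ pmin : ℝ, 0 < pmin ∧ ENNReal.ofReal pmin ≤ ⨅ (τ : ℝ) (_ : 0 < τ) (x : S),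
    πref x {a | qSoftStar M πref τ (x, a) =
      essSup (fun a' => qSoftStar M πref τ (x, a')) (πref x)}

/-! ### Soft distributional Bellman operators -/

/-- The soft distributional Bellman operator: the new measure at `(x, a)` is the law of
`r(x, a) + γ Z' - γ τ KL(π_{X'} ‖ πref_{X'})`, where `(X', A')` is drawn from the state-action
transition kernel of `π` at `(x, a)` and `Z' ∼ ζ_{X',A'}`. -/
def softDistBellman (M : MDP S A) (πref : Kernel S A) (τ : ℝ) (π : Kernel S A)
    (ζ : Kernel (S × A) ℝ) : Kernel (S × A) ℝ :=
  (Kernel.id ×ₖ (step M π ⊗ₖ ζ.prodMkLeft (S × A))).map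
    fun w : (S × A) × (S × A) × ℝ =>
      M.r w.1 + M.γ * w.2.2 - M.γ * τ * klFn π πref w.2.1.1

/-- The soft distributional optimality operator: evaluate the Boltzmann-Gibbs policy of the mean
of `ζ`. -/
def softDistBellmanOpt (M : MDP S A) (πref : Kernel S A) [IsSFiniteKernel πref] (τ : ℝ)
    (ζ : Kernel (S × A) ℝ) : Kernel (S × A) ℝ :=
  softDistBellman M πref τ (boltzmann πref τ (meanQ ζ)) ζ

/-- The control iterates `ζ^0 = T ζ`, `ζ^{n+1} = T ζ^n`, with `T` the soft distributional
optimality operator. -/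
def controlIter (M : MDP S A) (πref : Kernel S A) [IsSFiniteKernel πref] (τ : ℝ)
    (ζ : Kernel (S × A) ℝ) : ℕ → Kernel (S × A) ℝ
  | 0 => softDistBellmanOpt M πref τ ζ
  | n + 1 => softDistBellmanOpt M πref τ (controlIter M πref τ ζ n)

end DERL

end

/-! On means, the soft distributional optimality operator is the soft Bellman optimality operator
(`meanQ_softDistBellmanOpt`), because the divergence penalty turns the mean of `q` under its
Boltzmann-Gibbs policy into the soft value (`mul_klFn_boltzmann`). That operator is a
`γ`-contraction in the supremum norm, so the means of the iterates reach `q*_τ` within errors `e n =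
γ ^ n * E`.

Coverage is used through one inequality: keeping only the maximizers in `∫ exp (q*_τ / τ)` shows
that the essential supremum of `q*_τ` exceeds its soft value by at most `τ * L`, with `L`
independent of `τ`. Comparing Bellman equations, `q*_ref - q*_τ` is at most `γ τ L / (1 - γ)`. Also
`τ KL ≤ τ L` for the policy `π^{τ,*}`, so deleting the penalties moves its return by at most the
same amount along every trajectory. Since the penalty is nonnegative, `q^π ≥ q*_τ` for this policy.
A small `τ` then gives the first two claims.

For the iterates, the evaluated policy changes with the kernel, so contraction for a fixed policy
does not suffice. Each iterate is instead coupled with the limit return distribution `ζ^{π^{τ,*}}`.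
The current Boltzmann-Gibbs policy contains `s n = exp (-2 e n / τ)` times `π^{τ,*}`
(`exists_boltzmann_mixture`). On that part both sides take the same action, and on the remaining
mass `1 - s n` they are coupled independently. The cost `D n` then satisfies `D (n+1) = γ (D n + (1
- s n) ^ (1/p) (D n + 2 C)) + γ (τ L + 2 e n)`, a perturbed contraction with limiting level `γ τ L /
(1 - γ) ≤ δ / 2 < δ`. Couplings are carried as kernels (`HasCoupling`), so no measurable selection
is needed when they are averaged over the next state and action. -/

noncomputable section

namespace DERL

open Filter Topology

universe u v

variable {S : Type u} {A : Type v} [MeasurableSpace S] [MeasurableSpace A]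

/-! ### Bounded measurable functions and contractions -/

/-- A contraction, in the supremum norm, of the bounded measurable functions has a fixed point. -/
theorem exists_fixedPoint_of_contraction {γ : ℝ} (hγ0 : 0 ≤ γ) (hγ1 : γ < 1)
    (T : (S × A → ℝ) → S × A → ℝ) (hT : ∀ q, IsBddMeas q → IsBddMeas (T q))
    (hc : ∀ q q', IsBddMeas q → IsBddMeas q' → ∀ C : ℝ, (∀ y, |q y - q' y| ≤ C) →
      ∀ y, |T q y - T q' y| ≤ γ * C) :
    ∃ q, IsBddMeas q ∧ T q = q := by
  have h0 : IsBddMeas (fun _ : S × A => (0 : ℝ)) := ⟨measurable_const, 0, by simp⟩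
  set w : ℕ → S × A → ℝ := fun n => T^[n] fun _ => 0 with hw
  have hw1 : ∀ n, w (n + 1) = T (w n) := fun n => by
    simp only [hw, Function.iterate_succ_apply']
  have hwb : ∀ n, IsBddMeas (w n) := by
    intro n
    induction n with
    | zero => exact h0
    | succ n ih => rw [hw1]; exact hT _ ih
  obtain ⟨C, hC⟩ := (hwb 1).2
  have hstep : ∀ n y, dist (w n y) (w (n + 1) y) ≤ C * γ ^ n := by
    intro n
    induction n with
    | zero =>
      intro y
      have := hC y
      simp only [hw, Function.iterate_zero, id, Real.dist_eq, zero_sub, abs_neg, pow_zero, mul_one,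
        zero_add] at this ⊢
      exact this
    | succ n ih =>
      intro y
      rw [Real.dist_eq, hw1 n, hw1 (n + 1)]
      refine (hc _ _ (hwb _) (hwb _) (C * γ ^ n) (fun y => ?_) y).trans_eq (by ring)
      have := ih y
      rwa [Real.dist_eq] at this
  have hlim : ∀ y, ∃ l, Tendsto (fun n => w n y) atTop (𝓝 l) := fun y =>
    cauchySeq_tendsto_of_complete
      (cauchySeq_of_le_geometric γ C hγ1 fun n => hstep n y)
  choose q hq using hlim
  -- The bound is uniform in `y`, so `hc` applies to the pair `w n`, `q`, and boundedness of the
  -- pointwise limit follows from `n = 0`.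
  have hdist : ∀ n y, |w n y - q y| ≤ C * γ ^ n / (1 - γ) := fun n y => by
    rw [← Real.dist_eq]
    exact dist_le_of_le_geometric_of_tendsto γ C hγ1 (fun n => hstep n y) (hq y) n
  have hqb : IsBddMeas q := by
    refine ⟨measurable_of_tendsto_metrizable (fun n => (hwb n).1) (tendsto_pi_nhds.2 hq),
      C * γ ^ 0 / (1 - γ), fun y => ?_⟩
    simpa [hw] using hdist 0 y
  refine ⟨q, hqb, funext fun y => ?_⟩
  have hb : ∀ n, |T q y - q y| ≤ 2 * (C * γ ^ (n + 1) / (1 - γ)) := by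
    intro n
    have h1 := hc _ _ (hwb n) hqb _ (hdist n) y
    have h2 := hdist (n + 1) y
    rw [hw1] at h2
    have h3 : γ * (C * γ ^ n / (1 - γ)) = C * γ ^ (n + 1) / (1 - γ) := by ring
    rw [h3] at h1
    have := abs_sub_le (T q y) (T (w n) y) (q y)
    rw [abs_sub_comm (T q y) (T (w n) y)] at this
    linarith
  have hz : Tendsto (fun n : ℕ => 2 * (C * γ ^ (n + 1) / (1 - γ))) atTop (𝓝 0) := by
    have := ((tendsto_pow_atTop_nhds_zero_of_lt_one hγ0 hγ1).comp (tendsto_add_atTop_nat 1))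
    have := ((this.const_mul C).div_const (1 - γ)).const_mul 2
    simpa using this
  have := ge_of_tendsto' hz hb
  exact sub_eq_zero.1 (abs_nonpos_iff.1 this)

/-- If a lower bound `-C` of a bounded function always improves to `-(γ C + k)`, then
`-k / (1 - γ)` is a lower bound. -/
theorem lower_bound_of_contraction {Y : Type*} {γ k : ℝ} (hγ0 : 0 ≤ γ) (hγ1 : γ < 1) (d : Y → ℝ)
    (hd : ∃ C : ℝ, ∀ y, |d y| ≤ C)
    (h : ∀ C : ℝ, (∀ y, -C ≤ d y) → ∀ y, -(γ * C + k) ≤ d y) (y : Y) :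
    -(k / (1 - γ)) ≤ d y := by
  obtain ⟨C, hC⟩ := hd
  have h1 : 0 < 1 - γ := by linarith
  -- `k / (1 - γ)` is the fixed point of `C ↦ γ C + k`. The absolute value makes the bound at `n =
  -- 0` hold whatever the sign of `k`.
  set D := C + |k / (1 - γ)|
  have key : ∀ n : ℕ, ∀ y, -(k / (1 - γ) + γ ^ n * D) ≤ d y := by
    intro n
    induction n with
    | zero =>
      intro y
      have := neg_abs_le (d y)
      have := hC y
      have := neg_abs_le (k / (1 - γ))
      simp only [pow_zero, one_mul, D]
      linarith
    | succ n ih =>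
      intro y
      have := h _ ih y
      have e : γ * (k / (1 - γ) + γ ^ n * D) + k = k / (1 - γ) + γ ^ (n + 1) * D := by
        field_simp; ring
      rwa [e] at this
  have hz : Tendsto (fun n : ℕ => -(k / (1 - γ) + γ ^ n * D)) atTop (𝓝 (-(k / (1 - γ)))) := by
    have := (((tendsto_pow_atTop_nhds_zero_of_lt_one hγ0 hγ1).mul_const D).const_add
      (k / (1 - γ))).neg
    simpa using this
  exact le_of_tendsto' hz fun n => key n y

theorem IsBddMeas.section_measurable {q : S × A → ℝ} (hq : IsBddMeas q) (x : S) :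
    Measurable fun a => q (x, a) := hq.1.comp measurable_prodMk_left

theorem integrable_of_abs_le {Ω : Type*} [MeasurableSpace Ω] {μ : Measure Ω} [IsFiniteMeasure μ]
    {f : Ω → ℝ} (hf : Measurable f) {C : ℝ} (hC : ∀ z, |f z| ≤ C) : Integrable f μ :=
  Integrable.of_bound hf.aestronglyMeasurable C (ae_of_all _ hC)

theorem integral_abs_le {Ω : Type*} [MeasurableSpace Ω] {μ : Measure Ω} [IsProbabilityMeasure μ]
    {f : Ω → ℝ} {C : ℝ} (hC : ∀ z, |f z| ≤ C) : |∫ z, f z ∂μ| ≤ C := by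
  have := norm_integral_le_of_norm_le_const (μ := μ) (f := f) (ae_of_all _ hC)
  simpa using this

/-- Monotonicity of the mean, with an additive error, for bounded measurable functions. -/
theorem integral_le_integral_add {Ω : Type*} [MeasurableSpace Ω] {μ : Measure Ω}
    [IsProbabilityMeasure μ] {f g : Ω → ℝ} (hf : Integrable f μ) (hg : Integrable g μ) {C : ℝ}
    (h : ∀ z, f z ≤ g z + C) : ∫ z, f z ∂μ ≤ ∫ z, g z ∂μ + C := by
  have := integral_mono hf (hg.add (integrable_const C)) h
  simpa [integral_add hg (integrable_const C)] using this

/-! ### The soft value function -/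

section SoftValue

variable (πref : Kernel S A) [IsMarkovKernel πref] {τ : ℝ}

theorem integrable_exp_div {q : S × A → ℝ} (hq : IsBddMeas q) (hτ : 0 < τ) (x : S)
    (μ : Measure A) [IsFiniteMeasure μ] : Integrable (fun a => Real.exp (q (x, a) / τ)) μ := by
  obtain ⟨C, hC⟩ := hq.2
  refine integrable_of_abs_le ((hq.section_measurable x).div_const τ).exp
    (C := Real.exp (C / τ)) fun a => ?_
  rw [abs_of_pos (Real.exp_pos _)]
  gcongr
  exact (le_abs_self _).trans (hC _)

theorem integral_exp_div_pos {q : S × A → ℝ} (hq : IsBddMeas q) (hτ : 0 < τ) (x : S) :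
    0 < ∫ a, Real.exp (q (x, a) / τ) ∂(πref x) :=
  integral_exp_pos (integrable_exp_div hq hτ x _)

theorem exp_softValue_div {q : S × A → ℝ} (hq : IsBddMeas q) (hτ : 0 < τ) (x : S) :
    Real.exp (softValue πref τ q x / τ) = ∫ a, Real.exp (q (x, a) / τ) ∂(πref x) := by
  rw [softValue, mul_div_cancel_left₀ _ hτ.ne', Real.exp_log (integral_exp_div_pos πref hq hτ x)]

/-- A shift by `C` becomes a factor `exp (C / τ)` inside the integral, which the logarithm turns
back into `C`. Used in both directions, this makes the soft value nonexpansive. -/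
theorem softValue_le_add {q q' : S × A → ℝ} (hq : IsBddMeas q) (hq' : IsBddMeas q') (hτ : 0 < τ)
    {C : ℝ} (h : ∀ y, q y ≤ q' y + C) (x : S) :
    softValue πref τ q x ≤ softValue πref τ q' x + C := by
  have hle : ∫ a, Real.exp (q (x, a) / τ) ∂(πref x)
      ≤ (∫ a, Real.exp (q' (x, a) / τ) ∂(πref x)) * Real.exp (C / τ) := by
    rw [← integral_mul_const]
    refine integral_mono (integrable_exp_div hq hτ x _)
      ((integrable_exp_div hq' hτ x _).mul_const _) fun a => ?_
    simp only
    rw [← Real.exp_add, ← add_div]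
    gcongr
    exact h _
  have hlog := Real.log_le_log (integral_exp_div_pos πref hq hτ x) hle
  rw [Real.log_mul (integral_exp_div_pos πref hq' hτ x).ne' (Real.exp_pos _).ne', Real.log_exp]
    at hlog
  have := mul_le_mul_of_nonneg_left hlog hτ.le
  rw [mul_add, mul_div_cancel₀ _ hτ.ne'] at this
  exact this

theorem softValue_abs_sub_le {q q' : S × A → ℝ} (hq : IsBddMeas q) (hq' : IsBddMeas q')
    (hτ : 0 < τ) {C : ℝ} (h : ∀ y, |q y - q' y| ≤ C) (x : S) :
    |softValue πref τ q x - softValue πref τ q' x| ≤ C := by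
  rw [abs_sub_le_iff]
  constructor
  · have := softValue_le_add πref hq hq' hτ (C := C)
      (fun y => by linarith [(abs_sub_le_iff.1 (h y)).1]) x
    linarith
  · have := softValue_le_add πref hq' hq hτ (C := C)
      (fun y => by linarith [(abs_sub_le_iff.1 (h y)).2]) x
    linarith

theorem softValue_abs_le {q : S × A → ℝ} (hq : IsBddMeas q) (hτ : 0 < τ) {C : ℝ}
    (h : ∀ y, |q y| ≤ C) (x : S) : |softValue πref τ q x| ≤ C := by
  have h0 : IsBddMeas (fun _ : S × A => (0 : ℝ)) := ⟨measurable_const, 0, by simp⟩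
  have := softValue_abs_sub_le πref hq h0 hτ (C := C) (by simpa using h) x
  simpa [softValue] using this

theorem measurable_softValue {q : S × A → ℝ} (hq : IsBddMeas q) :
    Measurable (softValue πref τ q) := by
  unfold softValue
  refine (Real.measurable_log.comp ?_).const_mul τ
  refine (StronglyMeasurable.integral_kernel_prod_right' (κ := πref)
    (f := fun y : S × A => Real.exp (q y / τ)) ?_).measurable
  exact (hq.1.div_const τ).exp.stronglyMeasurable

end SoftValue

/-! ### Bellman operators on bounded measurable functions and their fixed points -/

section Bellman

variable (M : MDP S A) (πref : Kernel S A) [IsMarkovKernel πref] {τ : ℝ}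

/-- A Bellman operator `q ↦ r + γ P (F q)` preserves bounded measurable functions if `F` sends
them to bounded measurable functions. -/
theorem isBddMeas_bellman {f : S → ℝ} (hf : Measurable f) (hb : ∃ C : ℝ, ∀ x, |f x| ≤ C) :
    IsBddMeas fun y => M.r y + M.γ * ∫ x', f x' ∂(M.P y) := by
  obtain ⟨C, hC⟩ := hb
  obtain ⟨R, hR⟩ := M.bounded_r
  refine ⟨M.measurable_r.add (Measurable.const_mul
    (StronglyMeasurable.integral_kernel hf.stronglyMeasurable).measurable _),
    R + M.γ * C, fun y => ?_⟩
  refine (abs_add_le _ _).trans (add_le_add (hR y) ?_)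
  rw [abs_mul, abs_of_pos M.γ_pos]
  exact mul_le_mul_of_nonneg_left (integral_abs_le hC) M.γ_pos.le

theorem bellman_abs_sub_le {f g : S → ℝ} (hf : Measurable f) (hfb : ∃ C : ℝ, ∀ x, |f x| ≤ C)
    (hg : Measurable g) (hgb : ∃ C : ℝ, ∀ x, |g x| ≤ C) {C : ℝ} (h : ∀ x, |f x - g x| ≤ C)
    (y : S × A) :
    |(M.r y + M.γ * ∫ x', f x' ∂(M.P y)) - (M.r y + M.γ * ∫ x', g x' ∂(M.P y))| ≤ M.γ * C := by
  obtain ⟨C1, hC1⟩ := hfb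
  obtain ⟨C2, hC2⟩ := hgb
  rw [add_sub_add_left_eq_sub, ← mul_sub, abs_mul, abs_of_pos M.γ_pos,
    ← integral_sub (integrable_of_abs_le hf hC1) (integrable_of_abs_le hg hC2)]
  exact mul_le_mul_of_nonneg_left (integral_abs_le h) M.γ_pos.le

theorem isBddMeas_softBellmanOpt (hτ : 0 < τ) {q : S × A → ℝ} (hq : IsBddMeas q) :
    IsBddMeas (softBellmanOpt M πref τ q) :=
  isBddMeas_bellman M (measurable_softValue πref hq)
    (hq.2.imp fun _ h => softValue_abs_le πref hq hτ h)

theorem softBellmanOpt_abs_sub_le (hτ : 0 < τ) {q q' : S × A → ℝ} (hq : IsBddMeas q)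
    (hq' : IsBddMeas q') {C : ℝ} (h : ∀ y, |q y - q' y| ≤ C) (y : S × A) :
    |softBellmanOpt M πref τ q y - softBellmanOpt M πref τ q' y| ≤ M.γ * C :=
  bellman_abs_sub_le M (measurable_softValue πref hq)
    (hq.2.imp fun _ h => softValue_abs_le πref hq hτ h) (measurable_softValue πref hq')
    (hq'.2.imp fun _ h => softValue_abs_le πref hq' hτ h)
    (softValue_abs_sub_le πref hq hq' hτ h) y

/-- Existence of a fixed point is all that `Classical.epsilon` requires; the later arguments hold
for any bounded measurable fixed point. -/
theorem qSoftStar_spec (hτ : 0 < τ) : IsBddMeas (qSoftStar M πref τ) ∧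
    softBellmanOpt M πref τ (qSoftStar M πref τ) = qSoftStar M πref τ :=
  Classical.epsilon_spec (exists_fixedPoint_of_contraction M.γ_pos.le M.γ_lt_one _
    (fun _ hq => isBddMeas_softBellmanOpt M πref hτ hq)
    (fun _ _ hq hq' _ h => softBellmanOpt_abs_sub_le M πref hτ hq hq' h))

/-! ### Essential suprema and the reference-optimality operator -/

/-- `ℝ` is only conditionally complete, so a bound on `|f|` must accompany each essential supremum
to exclude junk values. -/
theorem essSup_le_of_forall_le {Ω : Type*} [MeasurableSpace Ω] {μ : Measure Ω} [NeZero μ]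
    {f : Ω → ℝ} {B C : ℝ} (hB : ∀ z, |f z| ≤ B) (h : ∀ᵐ z ∂μ, f z ≤ C) : essSup f μ ≤ C :=
  essSup_le_of_ae_le _ h (isCoboundedUnder_le_of_le _ (x := -B) fun z => (abs_le.1 (hB z)).1)

theorem ae_le_essSup_of_abs_le {Ω : Type*} [MeasurableSpace Ω] {μ : Measure Ω}
    {f : Ω → ℝ} {B : ℝ} (hB : ∀ z, |f z| ≤ B) : ∀ᵐ z ∂μ, f z ≤ essSup f μ :=
  ae_le_essSup (hf := isBoundedUnder_of ⟨B, fun z => (abs_le.1 (hB z)).2⟩)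

theorem essSup_abs_le {Ω : Type*} [MeasurableSpace Ω] {μ : Measure Ω} [NeZero μ]
    {f : Ω → ℝ} {B : ℝ} (hB : ∀ z, |f z| ≤ B) : |essSup f μ| ≤ B := by
  refine abs_le.2 ⟨?_, essSup_le_of_forall_le hB (ae_of_all _ fun z => (abs_le.1 (hB z)).2)⟩
  obtain ⟨z, hz⟩ := (ae_le_essSup_of_abs_le (μ := μ) hB).exists
  exact ((abs_le.1 (hB z)).1).trans hz

theorem essSup_le_add {Ω : Type*} [MeasurableSpace Ω] {μ : Measure Ω} [NeZero μ]
    {f g : Ω → ℝ} {B B' C : ℝ} (hB : ∀ z, |f z| ≤ B) (hB' : ∀ z, |g z| ≤ B')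
    (h : ∀ z, f z ≤ g z + C) : essSup f μ ≤ essSup g μ + C := by
  refine essSup_le_of_forall_le hB ?_
  filter_upwards [ae_le_essSup_of_abs_le (μ := μ) hB'] with z hz
  linarith [h z]

/-- The essential supremum is at most `c` exactly when `{q > c}` has a null section, and masses of
sections are measurable in the base point. -/
theorem measurable_essSup {q : S × A → ℝ} (hq : IsBddMeas q) :
    Measurable fun x => essSup (fun a => q (x, a)) (πref x) := by
  obtain ⟨C, hC⟩ := hq.2
  refine measurable_of_Iic fun c => ?_
  have : (fun x => essSup (fun a => q (x, a)) (πref x)) ⁻¹' Iic c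
      = {x | πref x (Prod.mk x ⁻¹' {y | c < q y}) = 0} := by
    ext x
    simp only [mem_preimage, mem_Iic, mem_ofPred_eq]
    constructor
    · intro h
      have : ∀ᵐ a ∂(πref x), q (x, a) ≤ c := by
        filter_upwards [ae_le_essSup_of_abs_le (μ := πref x) (f := fun a => q (x, a))
          fun a => hC _] with a ha using ha.trans h
      simpa [ae_iff] using this
    · intro h
      refine essSup_le_of_forall_le (fun a => hC (x, a)) ?_
      rw [ae_iff]
      simpa using h
  rw [this]
  exact (Kernel.measurable_kernel_prodMk_left (κ := πref)
    (measurableSet_lt measurable_const hq.1)) (measurableSet_singleton 0)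

theorem qRefStar_spec : IsBddMeas (qRefStar M πref) ∧
    bellmanRef M πref (qRefStar M πref) = qRefStar M πref := by
  have hb : ∀ {q : S × A → ℝ}, IsBddMeas q →
      ∃ C : ℝ, ∀ x, |essSup (fun a => q (x, a)) (πref x)| ≤ C := fun hq =>
    hq.2.imp fun C hC x => essSup_abs_le fun a => hC (x, a)
  refine Classical.epsilon_spec (exists_fixedPoint_of_contraction M.γ_pos.le M.γ_lt_one _
    (fun q hq => isBddMeas_bellman M (measurable_essSup πref hq) (hb hq))
    (fun q q' hq hq' C h => bellman_abs_sub_le M (measurable_essSup πref hq) (hb hq)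
      (measurable_essSup πref hq') (hb hq') fun x => ?_))
  obtain ⟨B, hB⟩ := hq.2
  obtain ⟨B', hB'⟩ := hq'.2
  rw [abs_sub_le_iff, sub_le_iff_le_add', sub_le_iff_le_add']
  constructor
  · exact essSup_le_add (fun a => hB (x, a)) (fun a => hB' (x, a))
      fun a => by linarith [(abs_sub_le_iff.1 (h (x, a))).1]
  · exact essSup_le_add (fun a => hB' (x, a)) (fun a => hB (x, a))
      fun a => by linarith [(abs_sub_le_iff.1 (h (x, a))).2]

end Bellman

/-! ### Boltzmann-Gibbs policies -/

section Boltzmann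

variable (πref : Kernel S A) {τ : ℝ}

/-- The density of the Boltzmann-Gibbs policy. -/
def gibbs (πref : Kernel S A) (τ : ℝ) (q : S × A → ℝ) (x : S) (a : A) : ℝ :=
  Real.exp ((q (x, a) - softValue πref τ q x) / τ)

theorem gibbs_pos (q : S × A → ℝ) (x : S) (a : A) : 0 < gibbs πref τ q x a := Real.exp_pos _

theorem klFn_nonneg (π : Kernel S A) (x : S) : 0 ≤ klFn π πref x := ENNReal.toReal_nonneg

variable [IsMarkovKernel πref]

theorem measurable_gibbs {q : S × A → ℝ} (hq : IsBddMeas q) :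
    Measurable (Function.uncurry (gibbs πref τ q)) :=
  ((hq.1.sub ((measurable_softValue πref hq).comp measurable_fst)).div_const τ).exp

theorem measurable_ofReal_gibbs {q : S × A → ℝ} (hq : IsBddMeas q) :
    Measurable (Function.uncurry fun x a => ENNReal.ofReal (gibbs πref τ q x a)) :=
  (measurable_gibbs πref hq).ennreal_ofReal

theorem boltzmann_apply {q : S × A → ℝ} (hq : IsBddMeas q) (x : S) :
    boltzmann πref τ q x = (πref x).withDensity fun a => ENNReal.ofReal (gibbs πref τ q x a) :=
  Kernel.withDensity_apply _ (measurable_ofReal_gibbs πref hq) x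

theorem gibbs_eq {q : S × A → ℝ} (hq : IsBddMeas q) (hτ : 0 < τ) (x : S) (a : A) :
    gibbs πref τ q x a = (∫ a, Real.exp (q (x, a) / τ) ∂(πref x))⁻¹ * Real.exp (q (x, a) / τ) := by
  rw [gibbs, sub_div, Real.exp_sub, exp_softValue_div πref hq hτ, div_eq_inv_mul]

theorem integrable_gibbs {q : S × A → ℝ} (hq : IsBddMeas q) (hτ : 0 < τ) (x : S) :
    Integrable (gibbs πref τ q x) (πref x) := by
  have : gibbs πref τ q x = fun a => (∫ a, Real.exp (q (x, a) / τ) ∂(πref x))⁻¹ *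
      Real.exp (q (x, a) / τ) := funext fun a => gibbs_eq πref hq hτ x a
  rw [this]
  exact (integrable_exp_div hq hτ x _).const_mul _

theorem integral_gibbs {q : S × A → ℝ} (hq : IsBddMeas q) (hτ : 0 < τ) (x : S) :
    ∫ a, gibbs πref τ q x a ∂(πref x) = 1 := by
  simp_rw [gibbs_eq πref hq hτ x]
  rw [integral_const_mul, inv_mul_cancel₀ (integral_exp_div_pos πref hq hτ x).ne']

theorem isMarkovKernel_boltzmann {q : S × A → ℝ} (hq : IsBddMeas q) (hτ : 0 < τ) :
    IsMarkovKernel (boltzmann πref τ q) := by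
  refine ⟨fun x => ⟨?_⟩⟩
  rw [boltzmann_apply πref hq, withDensity_apply _ MeasurableSet.univ, Measure.restrict_univ,
    ← ofReal_integral_eq_lintegral_ofReal (integrable_gibbs πref hq hτ x)
      (ae_of_all _ fun a => (gibbs_pos πref q x a).le), integral_gibbs πref hq hτ, ENNReal.ofReal_one]

/-- The entropy identity `τ KL(π_x ‖ πref_x) = ∫ q(x, ·) dπ_x - (V_τ q)(x)` for the
Boltzmann-Gibbs policy `π` of `q`. -/
theorem mul_klFn_boltzmann {q : S × A → ℝ} (hq : IsBddMeas q) (hτ : 0 < τ) (x : S) :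
    τ * klFn (boltzmann πref τ q) πref x
      = ∫ a, q (x, a) ∂(boltzmann πref τ q x) - softValue πref τ q x := by
  have := isMarkovKernel_boltzmann πref hq hτ
  obtain ⟨C, hC⟩ := hq.2
  have hac : boltzmann πref τ q x ≪ πref x := by
    rw [boltzmann_apply πref hq]; exact withDensity_absolutelyContinuous _ _
  -- The logarithm of the density is affine in `q`, so the divergence is an explicit mean. Both
  -- measures have mass one, hence `klDiv` carries no mass correction.
  have hllr : llr (boltzmann πref τ q x) (πref x) =ᵐ[boltzmann πref τ q x]
      fun a => (q (x, a) - softValue πref τ q x) / τ := by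
    refine hac.ae_le ?_
    have hm : Measurable fun a => ENNReal.ofReal (gibbs πref τ q x a) :=
      (measurable_ofReal_gibbs πref hq).comp measurable_prodMk_left
    have := Measure.rnDeriv_withDensity (πref x) hm
    rw [← boltzmann_apply πref hq] at this
    filter_upwards [this] with a ha
    rw [llr, ha, ENNReal.toReal_ofReal (gibbs_pos πref q x a).le, gibbs, Real.log_exp]
  rw [klFn, InformationTheory.toReal_klDiv_of_measure_eq hac (by simp), integral_congr_ae hllr,
    integral_div, mul_div_cancel₀ _ hτ.ne',
    integral_sub (integrable_of_abs_le (hq.section_measurable x) fun a => hC (x, a))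
      (integrable_const _)]
  simp

/-- The entropy identity expresses the divergence through a kernel integral and the soft value, both
measurable in the state. -/
theorem measurable_klFn_boltzmann {q : S × A → ℝ} (hq : IsBddMeas q) (hτ : 0 < τ) :
    Measurable (klFn (boltzmann πref τ q) πref) := by
  have := isMarkovKernel_boltzmann πref hq hτ
  have : klFn (boltzmann πref τ q) πref
      = fun x => (∫ a, q (x, a) ∂(boltzmann πref τ q x) - softValue πref τ q x) / τ :=
    funext fun x => by rw [← mul_klFn_boltzmann πref hq hτ, mul_div_cancel_left₀ _ hτ.ne']
  rw [this]
  exact ((StronglyMeasurable.integral_kernel_prod_right' (κ := boltzmann πref τ q)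
    hq.1.stronglyMeasurable).measurable.sub (measurable_softValue πref hq)).div_const τ

/-- An almost sure upper bound on `q - V_τ q` bounds the divergence of the Boltzmann-Gibbs
policy. -/
theorem mul_klFn_boltzmann_le {q : S × A → ℝ} (hq : IsBddMeas q) (hτ : 0 < τ) (x : S) {k : ℝ}
    (h : ∀ᵐ a ∂(πref x), q (x, a) - softValue πref τ q x ≤ k) :
    τ * klFn (boltzmann πref τ q) πref x ≤ k := by
  have := isMarkovKernel_boltzmann πref hq hτ
  obtain ⟨C, hC⟩ := hq.2
  have hac : boltzmann πref τ q x ≪ πref x := by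
    rw [boltzmann_apply πref hq]; exact withDensity_absolutelyContinuous _ _
  rw [mul_klFn_boltzmann πref hq hτ, sub_le_iff_le_add]
  have : ∫ a, q (x, a) ∂(boltzmann πref τ q x)
      ≤ ∫ _, (k + softValue πref τ q x) ∂(boltzmann πref τ q x) := by
    refine integral_mono_ae (integrable_of_abs_le (hq.section_measurable x) fun a => hC (x, a))
      (integrable_const _) (hac.ae_le ?_)
    filter_upwards [h] with a ha
    linarith
  simpa using this

/-- If the maximizers of `q(x, ·)` have reference mass at least `c`, then the soft value is at
least the essential supremum minus `τ log (1 / c)`. -/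
theorem essSup_le_softValue_add {q : S × A → ℝ} (hq : IsBddMeas q) (hτ : 0 < τ) (x : S) {c : ℝ}
    (hc : 0 < c) (h : ENNReal.ofReal c ≤ πref x {a | q (x, a) =
      essSup (fun a' => q (x, a')) (πref x)}) :
    essSup (fun a' => q (x, a')) (πref x) ≤ softValue πref τ q x + τ * Real.log (1 / c) := by
  set m := essSup (fun a' => q (x, a')) (πref x)
  set E := {a | q (x, a) = m}
  have hE : MeasurableSet E := (hq.section_measurable x) (measurableSet_singleton m)
  have hc' : c ≤ (πref x).real E := by
    rw [Measure.real]
    exact (ENNReal.ofReal_le_iff_le_toReal (measure_ne_top _ _)).1 h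
  -- Only the contribution of the maximizers to the exponential integral is kept.
  have h1 : c * Real.exp (m / τ) ≤ ∫ a, Real.exp (q (x, a) / τ) ∂(πref x) := by
    calc c * Real.exp (m / τ) ≤ (πref x).real E * Real.exp (m / τ) := by gcongr
      _ = ∫ a in E, Real.exp (q (x, a) / τ) ∂(πref x) := by
        rw [setIntegral_congr_fun (g := fun _ => Real.exp (m / τ)) hE
          (fun a ha => by simp only [E, mem_ofPred_eq] at ha; simp only [ha])]
        simp
      _ ≤ _ := setIntegral_le_integral (integrable_exp_div hq hτ x _)
        (ae_of_all _ fun a => (Real.exp_pos _).le)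
  have h2 := Real.log_le_log (by positivity) h1
  rw [Real.log_mul hc.ne' (Real.exp_pos _).ne', Real.log_exp] at h2
  have h3 := mul_le_mul_of_nonneg_left h2 hτ.le
  rw [mul_add, mul_div_cancel₀ _ hτ.ne'] at h3
  rw [one_div, Real.log_inv, softValue]
  linarith

/-- The soft Bellman optimality operator, written with the Boltzmann-Gibbs policy. -/
theorem softBellmanOpt_eq (M : MDP S A) {q : S × A → ℝ} (hq : IsBddMeas q) (hτ : 0 < τ)
    (y : S × A) : softBellmanOpt M πref τ q y = M.r y + M.γ * ∫ x',
      (∫ a, q (x', a) ∂(boltzmann πref τ q x') - τ * klFn (boltzmann πref τ q) πref x')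
        ∂(M.P y) := by
  simp_rw [mul_klFn_boltzmann πref hq hτ, sub_sub_cancel]
  rfl

end Boltzmann

/-! ### The Markov property of trajectories -/

section Markov

open Preorder

variable {X : Type*}

/-- Appends one more state to a finite history. -/
def snocHistory (n : ℕ) (h : (Finset.Iic n → X) × X) (i : Finset.Iic (n + 1)) : X :=
  if hi : i.1 ≤ n then h.1 ⟨i.1, Finset.mem_Iic.2 hi⟩ else h.2

theorem frestrictLe_succ_eq_snocHistory (n : ℕ) (w : ℕ → X) :
    frestrictLe (π := fun _ : ℕ => X) (n + 1) w
      = snocHistory n (frestrictLe (π := fun _ : ℕ => X) n w, w (n + 1)) := by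
  ext i
  unfold snocHistory
  split_ifs with hi
  · rfl
  · have : i.1 = n + 1 := le_antisymm (Finset.mem_Iic.1 i.2) (by omega)
    simp [← this]

/-- Prepends a state to a trajectory. -/
def consTraj (z : X × (ℕ → X)) : ℕ → X
  | 0 => z.1
  | n + 1 => z.2 n

/-- Prepends a state to a finite history. -/
def consHistory (n : ℕ) (z : X × (Finset.Iic n → X)) (i : Finset.Iic (n + 1)) : X :=
  if hi : i.1 = 0 then z.1
  else z.2 ⟨i.1 - 1, Finset.mem_Iic.2 (by have := Finset.mem_Iic.1 i.2; omega)⟩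

theorem frestrictLe_consTraj (n : ℕ) (y : X) (w : ℕ → X) :
    frestrictLe (π := fun _ : ℕ => X) (n + 1) (consTraj (y, w))
      = consHistory n (y, frestrictLe (π := fun _ : ℕ => X) n w) := by
  ext ⟨i, hi⟩
  unfold consHistory
  cases i with
  | zero => simp [consTraj]
  | succ i => simp [consTraj]

variable [MeasurableSpace X] (K : Kernel X X)

/-- The transition kernel `K`, as a kernel in the history up to time `n`. -/
def histKernel (n : ℕ) : Kernel (Finset.Iic n → X) X :=
  K.comap (fun h => h ⟨n, Finset.mem_Iic.2 le_rfl⟩) (measurable_pi_apply _)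

theorem histKernel_apply (n : ℕ) (h : Finset.Iic n → X) :
    histKernel K n h = K (h ⟨n, Finset.mem_Iic.2 le_rfl⟩) := by
  rw [histKernel, Kernel.comap_apply]

variable [IsMarkovKernel K]

instance (n : ℕ) : IsMarkovKernel (histKernel K n) := by unfold histKernel; infer_instance

/-- The law of the Markov chain with transition kernel `K`, as a kernel in its starting point. -/
def chain : Kernel X (ℕ → X) :=
  (Kernel.traj (X := fun _ : ℕ => X) (histKernel K) 0).comap
    (fun y _ => y) (measurable_pi_lambda _ fun _ => measurable_id)

instance : IsMarkovKernel (chain K) := by unfold chain; infer_instance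

theorem chain_apply (y : X) : chain K y = Kernel.traj (X := fun _ : ℕ => X) (histKernel K) 0
    (fun _ => y) := by
  rw [chain, Kernel.comap_apply]

theorem measurable_snocHistory (n : ℕ) : Measurable (snocHistory (X := X) n) := by
  refine measurable_pi_lambda _ fun i => ?_
  unfold snocHistory
  split_ifs
  · exact (measurable_pi_apply _).comp measurable_fst
  · exact measurable_snd

theorem chain_map_zero (y : X) : (chain K y).map (fun w => w 0) = Measure.dirac y := by
  have h := Kernel.traj_map_frestrictLe_apply (X := fun _ : ℕ => X)
    (κ := histKernel K)
    0 0 (fun _ => y)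
  rw [Kernel.partialTraj_self, Kernel.id_apply, ← chain_apply] at h
  have h' := congrArg (Measure.map fun v : Finset.Iic 0 → X => v ⟨0, Finset.mem_Iic.2 le_rfl⟩) h
  rw [Measure.map_map (g := fun v : Finset.Iic 0 → X => v ⟨0, Finset.mem_Iic.2 le_rfl⟩)
    (measurable_pi_apply _) (measurable_frestrictLe 0),
    Measure.map_dirac' (f := fun v : Finset.Iic 0 → X => v ⟨0, Finset.mem_Iic.2 le_rfl⟩)
    (measurable_pi_apply _)] at h'
  exact h'

/-- The Markov property in test-function form; together with the initial law it determines the chain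
(`eq_chain`). -/
theorem lintegral_chain_succ (y : X) (n : ℕ) {F : (Finset.Iic n → X) × X → ℝ≥0∞}
    (hF : Measurable F) :
    ∫⁻ w, F (frestrictLe (π := fun _ : ℕ => X) n w, w (n + 1)) ∂(chain K y)
      = ∫⁻ w, ∫⁻ x, F (frestrictLe (π := fun _ : ℕ => X) n w, x) ∂(K (w n)) ∂(chain K y) := by
  have h := Kernel.partialTraj_compProd_eq_map_traj (X := fun _ : ℕ => X)
    (κ := histKernel K)
    (Nat.zero_le n) (x₀ := fun _ => y)
  rw [← Kernel.traj_map_frestrictLe_apply, ← chain_apply] at h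
  have hm : Measurable fun w : ℕ → X => (frestrictLe (π := fun _ : ℕ => X) n w, w (n + 1)) :=
    (measurable_frestrictLe n).prodMk (measurable_pi_apply _)
  have h2 := congrArg (fun μ => ∫⁻ z, F z ∂μ) h
  rw [lintegral_map hF hm, Measure.lintegral_compProd hF, lintegral_map] at h2
  · simp only [histKernel_apply] at h2
    exact h2.symm
  · exact Measurable.lintegral_kernel_prod_right' hF
  · exact measurable_frestrictLe n

/-- A kernel with the right starting point and the right conditional transitions is the law of the
Markov chain. -/
theorem eq_chain (η : Kernel X (ℕ → X)) [IsMarkovKernel η]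
    (h0 : ∀ y, (η y).map (fun w => w 0) = Measure.dirac y)
    (hs : ∀ y n, ∀ F : (Finset.Iic n → X) × X → ℝ≥0∞, Measurable F →
      ∫⁻ w, F (frestrictLe (π := fun _ : ℕ => X) n w, w (n + 1)) ∂(η y)
        = ∫⁻ w, ∫⁻ x, F (frestrictLe (π := fun _ : ℕ => X) n w, x) ∂(K (w n)) ∂(η y)) :
    η = chain K := by
  -- The laws of finite histories agree by induction on their length; `Kernel.eq_traj` then passes
  -- to infinite trajectories.
  have key : ∀ n y, (η y).map (frestrictLe (π := fun _ : ℕ => X) n)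
      = (chain K y).map (frestrictLe (π := fun _ : ℕ => X) n) := by
    intro n y
    induction n with
    | zero =>
      have hc : Measurable fun (x : X) (_ : Finset.Iic 0) => x :=
        measurable_pi_lambda _ fun _ => measurable_id
      have e : frestrictLe (π := fun _ : ℕ => X) 0
          = (fun (x : X) (_ : Finset.Iic 0) => x) ∘ fun w : ℕ → X => w 0 := by
        ext w i
        have : i.1 = 0 := Nat.le_zero.1 (Finset.mem_Iic.1 i.2)
        simp [this]
      rw [e, ← Measure.map_map hc (measurable_pi_apply 0),
        ← Measure.map_map hc (measurable_pi_apply 0), h0, chain_map_zero]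
    | succ n ih =>
      refine Measure.ext_of_lintegral _ fun f hf => ?_
      rw [lintegral_map hf (measurable_frestrictLe _), lintegral_map hf (measurable_frestrictLe _)]
      simp_rw [frestrictLe_succ_eq_snocHistory]
      have hF : Measurable fun z => f (snocHistory n z) := hf.comp (measurable_snocHistory n)
      rw [hs y n (fun z => f (snocHistory n z)) hF, lintegral_chain_succ K y n hF]
      have hG : Measurable fun h : Finset.Iic n → X =>
          ∫⁻ x, f (snocHistory n (h, x)) ∂(histKernel K n h) :=
        Measurable.lintegral_kernel_prod_right' hF
      have := congrArg (fun μ => ∫⁻ z, ∫⁻ x, f (snocHistory n (z, x))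
        ∂(histKernel K n z) ∂μ) ih
      rw [lintegral_map hG (measurable_frestrictLe _),
        lintegral_map hG (measurable_frestrictLe _)] at this
      simp only [histKernel_apply] at this
      exact this
  -- `Kernel.traj` starts from a history indexed by `Iic 0`, which is a single state; `η` is pulled
  -- back to that source.
  have h1 : η.comap (fun h : Finset.Iic 0 → X => h ⟨0, Finset.mem_Iic.2 le_rfl⟩)
      (measurable_pi_apply _) = Kernel.traj (X := fun _ : ℕ => X) (histKernel K) 0 := by
    refine Kernel.eq_traj (X := fun _ : ℕ => X) (histKernel K) _ fun b => Kernel.ext fun h => ?_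
    have hh : h = fun _ => h ⟨0, Finset.mem_Iic.2 le_rfl⟩ := by
      ext i
      have : i = ⟨0, Finset.mem_Iic.2 le_rfl⟩ :=
        Subtype.ext (Nat.le_zero.1 (Finset.mem_Iic.1 i.2))
      rw [this]
    rw [Kernel.map_apply _ (measurable_frestrictLe _), Kernel.comap_apply, key, chain_apply,
      ← hh, Kernel.traj_map_frestrictLe_apply]
  ext1 y
  rw [chain_apply, ← h1, Kernel.comap_apply]

theorem measurable_consTraj : Measurable (consTraj (X := X)) := by
  refine measurable_pi_lambda _ fun n => ?_
  cases n with
  | zero => exact measurable_fst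
  | succ n => exact (measurable_pi_apply n).comp measurable_snd

theorem measurable_consHistory (n : ℕ) : Measurable (consHistory (X := X) n) := by
  refine measurable_pi_lambda _ fun i => ?_
  unfold consHistory
  split_ifs
  · exact measurable_fst
  · exact (measurable_pi_apply _).comp measurable_snd

/-- First-step decomposition of the Markov chain. -/
theorem chain_eq_map_consTraj :
    chain K = (Kernel.id ×ₖ (chain K ∘ₖ K)).map consTraj := by
  have hl : ∀ (y : X) (f : (ℕ → X) → ℝ≥0∞), Measurable f →
      ∫⁻ w, f w ∂((Kernel.id ×ₖ (chain K ∘ₖ K)).map consTraj y)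
        = ∫⁻ y', ∫⁻ w, f (consTraj (y, w)) ∂(chain K y') ∂(K y) := by
    intro y f hf
    have hfc : Measurable fun z => f (consTraj z) := hf.comp measurable_consTraj
    rw [Kernel.map_apply _ measurable_consTraj, lintegral_map hf measurable_consTraj,
      Kernel.lintegral_prod _ _ _ hfc, Kernel.id_apply, lintegral_dirac',
      Kernel.lintegral_comp _ _ _ (g := fun w => f (consTraj (y, w)))
        (hfc.comp measurable_prodMk_left)]
    · exact Measurable.lintegral_prod_right' hfc
  have : IsMarkovKernel ((Kernel.id ×ₖ (chain K ∘ₖ K)).map (consTraj (X := X))) :=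
    Kernel.IsMarkovKernel.map _ measurable_consTraj
  -- Prepending `y` to a chain started from `K y` is checked to have the initial law and the
  -- transitions that characterize `chain K`.
  refine (eq_chain K _ (fun y => ?_) fun y n F hF => ?_).symm
  · refine Measure.ext_of_lintegral _ fun f hf => ?_
    rw [lintegral_map hf (measurable_pi_apply 0), hl y (fun w => f (w 0)) (hf.comp (measurable_pi_apply 0)),
      lintegral_dirac' _ hf]
    simp [consTraj]
  · rw [hl y (fun w => F (frestrictLe (π := fun _ : ℕ => X) n w, w (n + 1))) (hF.comp ((measurable_frestrictLe n).prodMk (measurable_pi_apply _))),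
      hl y (fun w => ∫⁻ x, F (frestrictLe (π := fun _ : ℕ => X) n w, x) ∂(K (w n)))]
    -- At time `0` the history is constantly `y` and the next state is the start of the tail. Later
    -- transitions are those of the tail, one index earlier.
    · cases n with
      | zero =>
        have e : ∀ w : ℕ → X, frestrictLe (π := fun _ : ℕ => X) 0 (consTraj (y, w))
            = fun _ => y := by
          intro w
          ext i
          have : i.1 = 0 := Nat.le_zero.1 (Finset.mem_Iic.1 i.2)
          simp [this, consTraj]
        simp_rw [e]
        simp only [consTraj, lintegral_const, measure_univ, mul_one]
        refine lintegral_congr fun y' => ?_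
        have hm : Measurable fun x : X => F (fun _ => y, x) := hF.comp measurable_prodMk_left
        have := lintegral_map (μ := chain K y') hm (measurable_pi_apply 0)
        rw [chain_map_zero, lintegral_dirac' _ hm] at this
        exact this.symm
      | succ n =>
        simp_rw [frestrictLe_consTraj]
        refine lintegral_congr fun y' => ?_
        exact lintegral_chain_succ K y' n
          (F := fun z => F (consHistory n (y, z.1), z.2))
          (hF.comp (((measurable_consHistory n).comp
            (measurable_const.prodMk measurable_fst)).prodMk measurable_snd))
    · exact Measurable.lintegral_kernel_prod_right'
        (κ := K.comap (fun w : ℕ → X => w n) (measurable_pi_apply n))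
        (f := fun z : (ℕ → X) × X => F (frestrictLe (π := fun _ : ℕ => X) n z.1, z.2))
        (hF.comp (((measurable_frestrictLe n).comp measurable_fst).prodMk measurable_snd))

end Markov

/-! ### Return distributions -/

section Returns

variable (M : MDP S A) (π : Kernel S A)

/-- The discounted return of a trajectory. -/
def discountedReturn (w : ℕ → S × A) : ℝ := ∑' t : ℕ, M.γ ^ t * M.r (w t)

theorem summable_discounted {γ C : ℝ} (hγ0 : 0 ≤ γ) (hγ1 : γ < 1) {f : ℕ → ℝ}
    (hf : ∀ t, |f t| ≤ C) : Summable fun t => γ ^ t * f t := by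
  refine Summable.of_norm_bounded ((summable_geometric_of_lt_one hγ0 hγ1).mul_right C) fun t => ?_
  rw [norm_mul, norm_pow, Real.norm_of_nonneg hγ0]
  exact mul_le_mul_of_nonneg_left (hf t) (by positivity)

theorem abs_tsum_discounted_le {γ C : ℝ} (hγ0 : 0 ≤ γ) (hγ1 : γ < 1) {f : ℕ → ℝ}
    (hf : ∀ t, |f t| ≤ C) : |∑' t, γ ^ t * f t| ≤ C / (1 - γ) := by
  have := tsum_of_norm_bounded (f := fun t => γ ^ t * f t) (a := (1 - γ)⁻¹ * C)
    ((hasSum_geometric_of_lt_one hγ0 hγ1).mul_right C) fun t => ?_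
  · rwa [Real.norm_eq_abs, mul_comm, ← div_eq_mul_inv] at this
  · rw [norm_mul, norm_pow, Real.norm_of_nonneg hγ0]
    exact mul_le_mul_of_nonneg_left (hf t) (by positivity)

theorem measurable_discountedReturn : Measurable (discountedReturn M) := by
  unfold discountedReturn
  have h : ∀ t : ℕ, Measurable fun w : ℕ → S × A => M.γ ^ t * M.r (w t) := fun t =>
    (M.measurable_r.comp (measurable_pi_apply t)).const_mul _
  exact Measurable.tsum h

theorem discountedReturn_consTraj (y : S × A) (w : ℕ → S × A) :
    discountedReturn M (consTraj (y, w)) = M.r y + M.γ * discountedReturn M w := by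
  obtain ⟨R, hR⟩ := M.bounded_r
  unfold discountedReturn
  rw [(summable_discounted M.γ_pos.le M.γ_lt_one
    (f := fun t => M.r (consTraj (y, w) t)) fun t => hR _).tsum_eq_zero_add, ← tsum_mul_left]
  simp only [pow_zero, one_mul, consTraj, pow_succ']
  congr 1
  exact tsum_congr fun t => by ring

/-- `trajectory M π` unfolds to the chain of `step M π`, so the first-step decomposition applies to
returns. -/
theorem returnDist_eq [IsMarkovKernel π] :
    returnDist M π = (chain (step M π)).map (discountedReturn M) := by
  rw [returnDist, dif_pos ‹_›]; rfl

instance [IsMarkovKernel π] : IsMarkovKernel (returnDist M π) := by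
  rw [returnDist_eq]
  exact Kernel.IsMarkovKernel.map _ (measurable_discountedReturn M)

/-- The distributional Bellman equation. -/
theorem lintegral_returnDist [IsMarkovKernel π] (y : S × A) {f : ℝ → ℝ≥0∞} (hf : Measurable f) :
    ∫⁻ z, f z ∂(returnDist M π y)
      = ∫⁻ y', ∫⁻ z, f (M.r y + M.γ * z) ∂(returnDist M π y') ∂(step M π y) := by
  have hfG : Measurable fun w => f (discountedReturn M w) :=
    hf.comp (measurable_discountedReturn M)
  have haff : Measurable fun z => f (M.r y + M.γ * z) :=
    hf.comp ((measurable_id.const_mul _).const_add _)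
  have hfGc : Measurable fun z => f (discountedReturn M (consTraj z)) :=
    hfG.comp measurable_consTraj
  have hc : chain (step M π) y
      = ((Kernel.id ×ₖ (chain (step M π) ∘ₖ step M π)) y).map consTraj := by
    conv_lhs => rw [chain_eq_map_consTraj, Kernel.map_apply _ measurable_consTraj]
  rw [returnDist_eq, Kernel.map_apply _ (measurable_discountedReturn M),
    lintegral_map hf (measurable_discountedReturn M), hc, lintegral_map hfG measurable_consTraj,
    Kernel.lintegral_prod _ _ _ hfGc, Kernel.id_apply,
    lintegral_dirac' _ (Measurable.lintegral_prod_right' hfGc)]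
  simp only [discountedReturn_consTraj]
  rw [Kernel.lintegral_comp _ _ _ (g := fun w => f (M.r y + M.γ * discountedReturn M w))
    (haff.comp (measurable_discountedReturn M))]
  refine lintegral_congr fun y' => ?_
  rw [Kernel.map_apply _ (measurable_discountedReturn M),
    lintegral_map haff (measurable_discountedReturn M)]

theorem returnDist_abs_le [IsMarkovKernel π] {R : ℝ} (hR : ∀ y, |M.r y| ≤ R) (y : S × A) :
    ∀ᵐ z ∂(returnDist M π y), |z| ≤ R / (1 - M.γ) := by
  rw [returnDist_eq, Kernel.map_apply _ (measurable_discountedReturn M),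
    ae_map_iff (p := fun z => |z| ≤ R / (1 - M.γ)) (measurable_discountedReturn M).aemeasurable
      (measurableSet_le measurable_norm measurable_const)]
  exact ae_of_all _ fun w => abs_tsum_discounted_le M.γ_pos.le M.γ_lt_one fun t => hR _

theorem isBddMeas_qValue [IsMarkovKernel π] : IsBddMeas (qValue M π) := by
  obtain ⟨R, hR⟩ := M.bounded_r
  refine ⟨(StronglyMeasurable.integral_kernel (κ := returnDist M π)
    measurable_id.stronglyMeasurable).measurable, R / (1 - M.γ), fun y => ?_⟩
  have := norm_integral_le_of_norm_le_const (μ := returnDist M π y) (f := id)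
    (returnDist_abs_le M π hR y)
  simpa [qValue, meanQ] using this

/-- The pushforward form of the distributional Bellman equation, suited to the signed integrals
defining `q^π`. -/
theorem returnDist_eq_map [IsMarkovKernel π] (y : S × A) :
    returnDist M π y = ((returnDist M π ∘ₖ step M π) y).map fun z => M.r y + M.γ * z := by
  have hm : Measurable fun z : ℝ => M.r y + M.γ * z := (measurable_id.const_mul _).const_add _
  refine Measure.ext_of_lintegral _ fun f hf => ?_
  rw [lintegral_returnDist M π y hf, lintegral_map hf hm,
    Kernel.lintegral_comp _ _ _ (g := fun z => f (M.r y + M.γ * z)) (hf.comp hm)]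

/-- The Bellman equation of `q^π`. -/
theorem qValue_eq [IsMarkovKernel π] (y : S × A) :
    qValue M π y = M.r y + M.γ * ∫ x', ∫ a', qValue M π (x', a') ∂(π x') ∂(M.P y) := by
  obtain ⟨R, hR⟩ := M.bounded_r
  obtain ⟨C, hC⟩ := (isBddMeas_qValue M π).2
  have hm : Measurable fun z : ℝ => M.r y + M.γ * z := (measurable_id.const_mul _).const_add _
  have hint : Integrable (fun z => z) ((returnDist M π ∘ₖ step M π) y) := by
    refine Integrable.of_bound aestronglyMeasurable_id (R / (1 - M.γ)) ?_
    rw [Kernel.comp_apply]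
    refine Measure.ae_comp_of_ae_ae (measurableSet_le measurable_norm measurable_const)
      (ae_of_all _ fun y' => returnDist_abs_le M π hR y')
  have h1 : qValue M π y = ∫ z, (M.r y + M.γ * z) ∂((returnDist M π ∘ₖ step M π) y) := by
    rw [qValue, meanQ, returnDist_eq_map, integral_map hm.aemeasurable (f := fun z => z) aestronglyMeasurable_id]
  have h2 : ∫ z, z ∂((returnDist M π ∘ₖ step M π) y) = ∫ y', qValue M π y' ∂(step M π y) :=
    Kernel.integral_comp hint
  have h3 : ∫ y', qValue M π y' ∂(step M π y)
      = ∫ x', ∫ a', qValue M π (x', a') ∂(π x') ∂(M.P y) := by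
    have hi : Integrable (qValue M π) (step M π y) :=
      integrable_of_abs_le (isBddMeas_qValue M π).1 hC
    rw [step] at hi ⊢
    rw [integral_compProd hi]
    rfl
  rw [h1, integral_add (integrable_const _) (hint.const_mul _), integral_const_mul, h2, h3]
  simp

end Returns

/-! ### Couplings of return distributions -/

section Coupling

/-- Minkowski's inequality for bounds on `p`-th moments. -/
theorem lintegral_add_rpow_le {Ω : Type*} [MeasurableSpace Ω] {μ : Measure Ω} {p : ℝ} (hp : 1 ≤ p)
    {f g : Ω → ℝ≥0∞} (hf : AEMeasurable f μ) (hg : AEMeasurable g μ) {a b : ℝ≥0∞}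
    (ha : ∫⁻ z, f z ^ p ∂μ ≤ a ^ p) (hb : ∫⁻ z, g z ^ p ∂μ ≤ b ^ p) :
    ∫⁻ z, (f z + g z) ^ p ∂μ ≤ (a + b) ^ p := by
  have hp0 : 0 < p := by linarith
  have h := ENNReal.lintegral_Lp_add_le hf hg hp
  simp only [Pi.add_apply, one_div] at h
  rw [← ENNReal.rpow_inv_le_iff hp0]
  exact h.trans (add_le_add ((ENNReal.rpow_inv_le_iff hp0).2 ha)
    ((ENNReal.rpow_inv_le_iff hp0).2 hb))

theorem wass_le_of_coupling {p : ℝ} (hp : 1 ≤ p) {μ ν : Measure ℝ} (c : Measure (ℝ × ℝ))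
    (h1 : c.fst = μ) (h2 : c.snd = ν) {d : ℝ≥0∞}
    (hd : ∫⁻ z, edist z.1 z.2 ^ p ∂c ≤ d ^ p) : wass p μ ν ≤ d := by
  have hp0 : 0 < p := by linarith
  rw [wass, one_div, ENNReal.rpow_inv_le_iff hp0]
  exact (iInf₂_le c ⟨h1, h2⟩).trans hd

theorem muWass_le_of_forall {Y : Type*} [MeasurableSpace Y] {p q : ℝ} (hq : 1 ≤ q)
    {ω : Measure Y} [IsProbabilityMeasure ω] {κ κ' : Kernel Y ℝ} {d : ℝ≥0∞}
    (h : ∀ y, wass p (κ y) (κ' y) ≤ d) : muWass p q ω κ κ' ≤ d := by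
  have hq0 : 0 < q := by linarith
  rw [muWass, one_div, ENNReal.rpow_inv_le_iff hq0]
  calc ∫⁻ y, wass p (κ y) (κ' y) ^ q ∂ω ≤ ∫⁻ _, d ^ q ∂ω :=
        lintegral_mono fun y => ENNReal.rpow_le_rpow (h y) hq0.le
    _ = d ^ q := by simp

/-- Two kernels admit a measurable family of couplings with `p`-cost at most `d`. -/
def HasCoupling {Y : Type*} [MeasurableSpace Y] (p : ℝ) (κ κ' : Kernel Y ℝ) (d : ℝ≥0∞) : Prop :=
  ∃ c : Kernel Y (ℝ × ℝ), (∀ y, (c y).fst = κ y) ∧ (∀ y, (c y).snd = κ' y) ∧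
    ∀ y, ∫⁻ z, edist z.1 z.2 ^ p ∂(c y) ≤ d ^ p

theorem HasCoupling.wass_le {Y : Type*} [MeasurableSpace Y] {p : ℝ} (hp : 1 ≤ p)
    {κ κ' : Kernel Y ℝ} {d : ℝ≥0∞} (h : HasCoupling p κ κ' d) (y : Y) :
    wass p (κ y) (κ' y) ≤ d := by
  obtain ⟨c, h1, h2, hd⟩ := h
  exact wass_le_of_coupling hp (c y) (h1 y) (h2 y) (hd y)

theorem lintegral_enorm_rpow_le_of_ae {μ : Measure ℝ} [IsProbabilityMeasure μ] {p : ℝ}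
    (hp : 1 ≤ p) {C : ℝ} (h : ∀ᵐ z ∂μ, |z| ≤ C) :
    ∫⁻ z, ‖z‖ₑ ^ p ∂μ ≤ ENNReal.ofReal C ^ p := by
  calc ∫⁻ z, ‖z‖ₑ ^ p ∂μ ≤ ∫⁻ _, ENNReal.ofReal C ^ p ∂μ := by
        refine lintegral_mono_ae ?_
        filter_upwards [h] with z hz
        gcongr
        rw [Real.enorm_eq_ofReal_abs]
        exact ENNReal.ofReal_le_ofReal hz
    _ = ENNReal.ofReal C ^ p := by simp

theorem edist_le_enorm_add (a b : ℝ) : edist a b ≤ ‖a‖ₑ + ‖b‖ₑ := by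
  rw [edist_eq_enorm_sub]; exact enorm_sub_le

theorem enorm_le_edist_add (a b : ℝ) : ‖a‖ₑ ≤ edist a b + ‖b‖ₑ := by
  rw [edist_eq_enorm_sub]
  calc ‖a‖ₑ = ‖(a - b) + b‖ₑ := by rw [sub_add_cancel]
    _ ≤ _ := enorm_add_le _ _

theorem measurable_edist_rpow (p : ℝ) : Measurable fun z : ℝ × ℝ => edist z.1 z.2 ^ p :=
  measurable_edist.pow_const p

/-- The independent coupling. -/
theorem hasCoupling_prod {Y : Type*} [MeasurableSpace Y] {p : ℝ} (hp : 1 ≤ p)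
    {κ κ' : Kernel Y ℝ} [IsMarkovKernel κ] [IsMarkovKernel κ'] {a b : ℝ≥0∞}
    (ha : ∀ y, ∫⁻ z, ‖z‖ₑ ^ p ∂(κ y) ≤ a ^ p) (hb : ∀ y, ∫⁻ z, ‖z‖ₑ ^ p ∂(κ' y) ≤ b ^ p) :
    HasCoupling p κ κ' (a + b) := by
  have hp0 : 0 ≤ p := by linarith
  refine ⟨κ ×ₖ κ', fun y => ?_, fun y => ?_, fun y => ?_⟩
  · rw [Kernel.prod_apply, Measure.fst_prod]
  · rw [Kernel.prod_apply, Measure.snd_prod]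
  · rw [Kernel.prod_apply]
    refine (lintegral_mono fun z : ℝ × ℝ =>
      ENNReal.rpow_le_rpow (edist_le_enorm_add z.1 z.2) hp0).trans
      (lintegral_add_rpow_le hp measurable_fst.enorm.aemeasurable
        measurable_snd.enorm.aemeasurable ?_ ?_)
    · have h := ha y
      rw [← Measure.fst_prod (μ := κ y) (ν := κ' y), Measure.fst,
        lintegral_map (measurable_enorm.pow_const p) measurable_fst] at h
      exact h
    · have h := hb y
      rw [← Measure.snd_prod (μ := κ y) (ν := κ' y), Measure.snd,
        lintegral_map (measurable_enorm.pow_const p) measurable_snd] at h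
      exact h

/-- The `p`-th moments of a kernel coupled to a kernel with bounded moments. -/
theorem HasCoupling.moment_le {Y : Type*} [MeasurableSpace Y] {p : ℝ} (hp : 1 ≤ p)
    {κ κ' : Kernel Y ℝ} {d b : ℝ≥0∞} (h : HasCoupling p κ κ' d)
    (hb : ∀ y, ∫⁻ z, ‖z‖ₑ ^ p ∂(κ' y) ≤ b ^ p) (y : Y) :
    ∫⁻ z, ‖z‖ₑ ^ p ∂(κ y) ≤ (d + b) ^ p := by
  have hp0 : 0 ≤ p := by linarith
  obtain ⟨c, h1, h2, hd⟩ := h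
  have h := hb y
  rw [← h2 y, Measure.snd, lintegral_map (measurable_enorm.pow_const p) measurable_snd] at h
  rw [← h1 y, Measure.fst, lintegral_map (measurable_enorm.pow_const p) measurable_fst]
  exact (lintegral_mono fun z : ℝ × ℝ =>
    ENNReal.rpow_le_rpow (enorm_le_edist_add z.1 z.2) hp0).trans
    (lintegral_add_rpow_le hp measurable_edist.aemeasurable measurable_snd.enorm.aemeasurable
      (hd y) h)

/-- Averages a kernel over the action drawn from `π`. -/
def actionAvg {Z : Type*} [MeasurableSpace Z] (π : Kernel S A) (κ : Kernel (S × A) Z) :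
    Kernel S Z := κ ∘ₖ (Kernel.id ×ₖ π)

theorem lintegral_actionAvg {Z : Type*} [MeasurableSpace Z] (π : Kernel S A) [IsSFiniteKernel π]
    (κ : Kernel (S × A) Z) (x : S) {f : Z → ℝ≥0∞} (hf : Measurable f) :
    ∫⁻ z, f z ∂(actionAvg π κ x) = ∫⁻ a, ∫⁻ z, f z ∂(κ (x, a)) ∂(π x) := by
  have hm : Measurable fun y => ∫⁻ z, f z ∂(κ y) := hf.lintegral_kernel
  rw [actionAvg, Kernel.lintegral_comp _ _ _ hf, Kernel.lintegral_prod _ _ _ hm, Kernel.id_apply,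
    lintegral_dirac' _ (Measurable.lintegral_prod_right' hm)]

instance {Z : Type*} [MeasurableSpace Z] (π : Kernel S A) [IsMarkovKernel π]
    (κ : Kernel (S × A) Z) [IsMarkovKernel κ] : IsMarkovKernel (actionAvg π κ) := by
  unfold actionAvg; infer_instance

instance {Z : Type*} [MeasurableSpace Z] (π : Kernel S A) [IsFiniteKernel π]
    (κ : Kernel (S × A) Z) [IsMarkovKernel κ] : IsFiniteKernel (actionAvg π κ) := by
  unfold actionAvg; infer_instance

theorem measurable_softBackup (M : MDP S A) {k : S → ℝ} (hk : Measurable k) (τ : ℝ) :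
    Measurable fun w : (S × A) × (S × A) × ℝ =>
      M.r w.1 + M.γ * w.2.2 - M.γ * τ * k w.2.1.1 :=
  ((M.measurable_r.comp measurable_fst).add (measurable_snd.snd.const_mul _)).sub
    ((hk.comp measurable_snd.fst.fst).const_mul _)

theorem isMarkovKernel_softDistBellman (M : MDP S A) (πref : Kernel S A) (τ : ℝ) (π : Kernel S A)
    [IsMarkovKernel π] (hk : Measurable (klFn π πref)) (ς : Kernel (S × A) ℝ) [IsMarkovKernel ς] :
    IsMarkovKernel (softDistBellman M πref τ π ς) := by
  unfold softDistBellman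
  exact Kernel.IsMarkovKernel.map _ (measurable_softBackup M hk τ)

theorem lintegral_step (M : MDP S A) (π : Kernel S A) [IsMarkovKernel π] (y : S × A)
    {f : S × A → ℝ≥0∞} (hf : Measurable f) :
    ∫⁻ y', f y' ∂(step M π y) = ∫⁻ x', ∫⁻ a', f (x', a') ∂(π x') ∂(M.P y) := by
  rw [step, Kernel.lintegral_compProd _ _ _ hf]
  rfl

theorem lintegral_softDistBellman (M : MDP S A) (πref : Kernel S A) (τ : ℝ) (π : Kernel S A)
    [IsMarkovKernel π] (hk : Measurable (klFn π πref)) (ς : Kernel (S × A) ℝ) [IsMarkovKernel ς]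
    (y : S × A) {f : ℝ → ℝ≥0∞} (hf : Measurable f) :
    ∫⁻ z, f z ∂(softDistBellman M πref τ π ς y)
      = ∫⁻ x', ∫⁻ z, f (M.r y + M.γ * z - M.γ * τ * klFn π πref x') ∂(actionAvg π ς x')
          ∂(M.P y) := by
  have hb := measurable_softBackup M hk τ
  have hfb : Measurable fun w : (S × A) × (S × A) × ℝ =>
      f (M.r w.1 + M.γ * w.2.2 - M.γ * τ * klFn π πref w.2.1.1) := hf.comp hb
  rw [softDistBellman, Kernel.map_apply _ hb, lintegral_map hf hb,
    Kernel.lintegral_prod _ _ _ hfb, Kernel.id_apply,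
    lintegral_dirac' _ (Measurable.lintegral_prod_right' hfb),
    Kernel.lintegral_compProd (f := fun w : (S × A) × ℝ =>
      f (M.r y + M.γ * w.2 - M.γ * τ * klFn π πref w.1.1)) _ _ _
      (hfb.comp measurable_prodMk_left)]
  have h2 : Measurable fun y' : S × A => ∫⁻ z, f (M.r y + M.γ * z - M.γ * τ * klFn π πref y'.1)
      ∂(ς y') := by
    exact Measurable.lintegral_kernel_prod_right' (κ := ς) (f := fun w : (S × A) × ℝ =>
      f (M.r y + M.γ * w.2 - M.γ * τ * klFn π πref w.1.1)) (hfb.comp measurable_prodMk_left)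
  refine (lintegral_step M π y h2).trans (lintegral_congr fun x' => ?_)
  exact (lintegral_actionAvg π ς x' (f := fun z => f (M.r y + M.γ * z - M.γ * τ * klFn π πref x'))
    (hf.comp (((measurable_id.const_mul _).const_add _).sub_const _))).symm

theorem lintegral_returnDist_actionAvg (M : MDP S A) (π : Kernel S A) [IsMarkovKernel π]
    (y : S × A) {f : ℝ → ℝ≥0∞} (hf : Measurable f) :
    ∫⁻ z, f z ∂(returnDist M π y)
      = ∫⁻ x', ∫⁻ z, f (M.r y + M.γ * z) ∂(actionAvg π (returnDist M π) x') ∂(M.P y) := by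
  have hf' : Measurable fun z => f (M.r y + M.γ * z) :=
    hf.comp ((measurable_id.const_mul _).const_add _)
  rw [lintegral_returnDist M π y hf, lintegral_step M π y hf'.lintegral_kernel]
  exact lintegral_congr fun x' => (lintegral_actionAvg π _ x' hf').symm

/-- Couples the averages of two coupled kernels over the actions of two policies `π` and `π'`,
when `π` is a mixture of `π'` and a remainder. The remainder is coupled independently. -/
theorem exists_actionAvg_coupling {p : ℝ} (hp : 1 ≤ p) {π π' Q R : Kernel S A}
    [IsMarkovKernel π] [IsMarkovKernel π'] [IsFiniteKernel Q] [IsFiniteKernel R]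
    (hπ : ∀ x, π x = Q x + R x) {s t : ℝ≥0∞} (hst : s + t = 1) (hQ : ∀ x, Q x = s • π' x)
    {ς ζ : Kernel (S × A) ℝ} [IsMarkovKernel ς] [IsMarkovKernel ζ] {d C : ℝ≥0∞}
    (hc : HasCoupling p ς ζ d) (hC : ∀ y, ∀ᵐ z ∂(ζ y), ‖z‖ₑ ≤ C) :
    ∃ K : Kernel S (ℝ × ℝ), IsMarkovKernel K ∧ (∀ x, (K x).fst = actionAvg π ς x) ∧
      (∀ x, (K x).snd = actionAvg π' ζ x) ∧
      ∀ x, ∫⁻ z, edist z.1 z.2 ^ p ∂(K x) ≤ (d + t ^ (1 / p) * (d + 2 * C)) ^ p := by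
  have hp0 : 0 < p := by linarith
  have hs1 : s ≤ 1 := hst ▸ le_self_add
  have hRt : ∀ x, R x univ = t := fun x => by
    have h := congrArg (fun μ : Measure A => μ univ) (hπ x)
    simp only [Measure.add_apply, hQ, Measure.smul_apply, measure_univ, smul_eq_mul, mul_one] at h
    have : s + t = s + R x univ := by rw [hst, h]
    exact ((ENNReal.add_right_inj (ne_top_of_le_ne_top ENNReal.one_ne_top hs1)).1 this).symm
  -- Moments of `ς` come from its coupling with `ζ`: norm `d + C` for `z`, plus `C` for the
  -- constant.
  have hmom : ∀ y, ∫⁻ z, (‖z‖ₑ + C) ^ p ∂(ς y) ≤ (d + 2 * C) ^ p := fun y => by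
    have hζ : ∀ y, ∫⁻ z, ‖z‖ₑ ^ p ∂(ζ y) ≤ C ^ p := fun y => by
      calc ∫⁻ z, ‖z‖ₑ ^ p ∂(ζ y) ≤ ∫⁻ _, C ^ p ∂(ζ y) := by
            refine lintegral_mono_ae ?_
            filter_upwards [hC y] with z hz
            exact ENNReal.rpow_le_rpow hz hp0.le
        _ = C ^ p := by simp
    rw [two_mul, ← add_assoc]
    exact lintegral_add_rpow_le hp measurable_enorm.aemeasurable aemeasurable_const
      (hc.moment_le hp hζ y) (by simp)
  obtain ⟨c, hc1, hc2, hcd⟩ := hc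
  have hcM : IsMarkovKernel c := ⟨fun y => ⟨by
    rw [← Measure.fst_univ, hc1, measure_univ]⟩⟩
  -- On `Q = s • π'` both sides use the same action and the coupling `c`. On the remainder `R`, of
  -- mass `t`, they are independent, the second side keeping law `actionAvg π' ζ`; the weights `s`
  -- and `t` restore its full marginal.
  set K : Kernel S (ℝ × ℝ) := actionAvg Q c + actionAvg R ς ×ₖ actionAvg π' ζ with hK
  have hKl : ∀ x (f : ℝ × ℝ → ℝ≥0∞), Measurable f → ∫⁻ z, f z ∂(K x)
      = ∫⁻ a, ∫⁻ z, f z ∂(c (x, a)) ∂(Q x)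
        + ∫⁻ a, ∫⁻ z, ∫⁻ z', f (z, z') ∂(actionAvg π' ζ x) ∂(ς (x, a)) ∂(R x) := by
    intro x f hf
    rw [hK, add_apply, lintegral_add_measure, lintegral_actionAvg Q c x hf,
      Kernel.lintegral_prod _ _ _ hf, lintegral_actionAvg R ς x
        (f := fun z => ∫⁻ z', f (z, z') ∂(actionAvg π' ζ x)) (Measurable.lintegral_prod_right' hf)]
  have hfst : ∀ x, (K x).fst = actionAvg π ς x := fun x => by
    refine Measure.ext_of_lintegral _ fun f hf => ?_
    rw [Measure.fst, lintegral_map hf measurable_fst, hKl x (fun z => f z.1)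
      (hf.comp measurable_fst), lintegral_actionAvg π ς x hf, hπ, lintegral_add_measure]
    congr 1
    · refine lintegral_congr fun a => ?_
      rw [← hc1, Measure.fst, lintegral_map hf measurable_fst]
    · simp
  have hsnd : ∀ x, (K x).snd = actionAvg π' ζ x := fun x => by
    refine Measure.ext_of_lintegral _ fun f hf => ?_
    rw [Measure.snd, lintegral_map hf measurable_snd, hKl x (fun z => f z.2)
      (hf.comp measurable_snd)]
    have h1 : ∫⁻ a, ∫⁻ z, f z.2 ∂(c (x, a)) ∂(Q x) = s * ∫⁻ z, f z ∂(actionAvg π' ζ x) := by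
      rw [hQ, lintegral_smul_measure, lintegral_actionAvg π' ζ x hf, smul_eq_mul]
      congr 1
      refine lintegral_congr fun a => ?_
      rw [← hc2, Measure.snd, lintegral_map hf measurable_snd]
    rw [h1]
    simp only [lintegral_const, measure_univ, mul_one, hRt]
    rw [mul_comm _ t, ← add_mul, hst, one_mul]
  refine ⟨K, ⟨fun x => ⟨by rw [← Measure.fst_univ, hfst, measure_univ]⟩⟩, hfst, hsnd, fun x => ?_⟩
  rw [hKl x _ (measurable_edist_rpow p)]
  have h1 : ∫⁻ a, ∫⁻ z, edist z.1 z.2 ^ p ∂(c (x, a)) ∂(Q x) ≤ d ^ p := by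
    calc _ ≤ ∫⁻ _, d ^ p ∂(Q x) := lintegral_mono fun a => hcd (x, a)
      _ = d ^ p * s := by simp [hQ]
      _ ≤ d ^ p * 1 := by gcongr
      _ = d ^ p := mul_one _
  have h2 : ∀ z : ℝ, ∫⁻ z', edist z z' ^ p ∂(actionAvg π' ζ x) ≤ (‖z‖ₑ + C) ^ p := fun z => by
    rw [lintegral_actionAvg π' ζ x (f := fun z' => edist z z' ^ p)
      ((measurable_edist_rpow p).comp measurable_prodMk_left)]
    calc _ ≤ ∫⁻ a, ∫⁻ _, (‖z‖ₑ + C) ^ p ∂(ζ (x, a)) ∂(π' x) := by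
          refine lintegral_mono fun a => lintegral_mono_ae ?_
          filter_upwards [hC (x, a)] with z' hz'
          exact ENNReal.rpow_le_rpow ((edist_le_enorm_add z z').trans (by gcongr)) hp0.le
      _ = _ := by simp
  have h3 : ∫⁻ a, ∫⁻ z, ∫⁻ z', edist z z' ^ p ∂(actionAvg π' ζ x) ∂(ς (x, a)) ∂(R x)
      ≤ (t ^ (1 / p) * (d + 2 * C)) ^ p := by
    calc _ ≤ ∫⁻ _, (d + 2 * C) ^ p ∂(R x) :=
          lintegral_mono fun a => (lintegral_mono h2).trans (hmom (x, a))
      _ = (t ^ (1 / p) * (d + 2 * C)) ^ p := by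
          rw [lintegral_const, hRt, ENNReal.mul_rpow_of_nonneg _ _ hp0.le, ← ENNReal.rpow_mul,
            one_div, inv_mul_cancel₀ hp0.ne', ENNReal.rpow_one, mul_comm]
  -- The two parts combine by `a ^ p + b ^ p ≤ (a + b) ^ p`, valid for `p ≥ 1`.
  exact (add_le_add h1 h3).trans (ENNReal.add_rpow_le_rpow_add _ _ hp)

/-- One application of the soft distributional Bellman operator to a kernel coupled with the
return distribution of another policy. -/
theorem hasCoupling_softDistBellman (M : MDP S A) (πref : Kernel S A) {τ : ℝ} (hτ : 0 ≤ τ)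
    {p : ℝ} (hp : 1 ≤ p) {π π' Q R : Kernel S A}
    [IsMarkovKernel π] [IsMarkovKernel π'] [IsFiniteKernel Q] [IsFiniteKernel R]
    (hπ : ∀ x, π x = Q x + R x) {s t : ℝ≥0∞} (hst : s + t = 1) (hQ : ∀ x, Q x = s • π' x)
    (hk : Measurable (klFn π πref)) {k : ℝ} (hkle : ∀ x, τ * klFn π πref x ≤ k)
    {ς : Kernel (S × A) ℝ} [IsMarkovKernel ς] {d C : ℝ≥0∞}
    (hc : HasCoupling p ς (returnDist M π') d) (hC : ∀ y, ∀ᵐ z ∂(returnDist M π' y), ‖z‖ₑ ≤ C) :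
    HasCoupling p (softDistBellman M πref τ π ς) (returnDist M π')
      (ENNReal.ofReal M.γ * (d + t ^ (1 / p) * (d + 2 * C)) + ENNReal.ofReal (M.γ * k)) := by
  have hp0 : 0 < p := by linarith
  obtain ⟨K, hKM, hK1, hK2, hKd⟩ := exists_actionAvg_coupling hp hπ hst hQ hc hC
  set D := d + t ^ (1 / p) * (d + 2 * C)
  have hm1 : Measurable fun w : (S × A) × S × (ℝ × ℝ) =>
      M.r w.1 + M.γ * w.2.2.1 - M.γ * τ * klFn π πref w.2.1 :=
    ((M.measurable_r.comp measurable_fst).add (measurable_snd.snd.fst.const_mul _)).sub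
      ((hk.comp measurable_snd.fst).const_mul _)
  have hm2 : Measurable fun w : (S × A) × S × (ℝ × ℝ) => M.r w.1 + M.γ * w.2.2.2 :=
    (M.measurable_r.comp measurable_fst).add (measurable_snd.snd.snd.const_mul _)
  -- Both coordinates share the reward and the next state; only the first pays the penalty. Their
  -- difference is thus `γ` times the old one, up to `γ k`.
  set Φ : (S × A) × S × (ℝ × ℝ) → ℝ × ℝ := fun w =>
    (M.r w.1 + M.γ * w.2.2.1 - M.γ * τ * klFn π πref w.2.1, M.r w.1 + M.γ * w.2.2.2)
  have hΦ : Measurable Φ := hm1.prodMk hm2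
  have hc' : ∀ y (f : ℝ × ℝ → ℝ≥0∞), Measurable f →
      ∫⁻ z, f z ∂((Kernel.id ×ₖ (M.P ⊗ₖ K.prodMkLeft (S × A))).map Φ y)
        = ∫⁻ w, f (Φ (y, w)) ∂((M.P ⊗ₖ K.prodMkLeft (S × A)) y) := by
    intro y f hf
    have hfΦ : Measurable fun w => f (Φ w) := hf.comp hΦ
    rw [Kernel.map_apply _ hΦ, lintegral_map hf hΦ, Kernel.lintegral_prod _ _ _ hfΦ,
      Kernel.id_apply, lintegral_dirac' _ (Measurable.lintegral_prod_right' hfΦ)]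
  have hPK : ∀ y (f : S × (ℝ × ℝ) → ℝ≥0∞), Measurable f →
      ∫⁻ w, f w ∂((M.P ⊗ₖ K.prodMkLeft (S × A)) y) = ∫⁻ x', ∫⁻ z, f (x', z) ∂(K x') ∂(M.P y) := by
    intro y f hf
    rw [Kernel.lintegral_compProd _ _ _ hf]
    rfl
  refine ⟨(Kernel.id ×ₖ (M.P ⊗ₖ K.prodMkLeft (S × A))).map Φ, fun y => ?_, fun y => ?_,
    fun y => ?_⟩
  · refine Measure.ext_of_lintegral _ fun f hf => ?_
    rw [Measure.fst, lintegral_map hf measurable_fst, hc' y (fun z => f z.1)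
      (hf.comp measurable_fst), lintegral_softDistBellman M πref τ π hk ς y hf,
      hPK y (fun w => f (Φ (y, w)).1)
        ((hf.comp measurable_fst).comp (hΦ.comp measurable_prodMk_left))]
    refine lintegral_congr fun x' => ?_
    have hm : Measurable fun z => f (M.r y + M.γ * z - M.γ * τ * klFn π πref x') :=
      hf.comp (((measurable_id.const_mul _).const_add _).sub_const _)
    rw [← hK1, Measure.fst, lintegral_map hm measurable_fst]
  · refine Measure.ext_of_lintegral _ fun f hf => ?_
    rw [Measure.snd, lintegral_map hf measurable_snd, hc' y (fun z => f z.2)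
      (hf.comp measurable_snd), lintegral_returnDist_actionAvg M π' y hf,
      hPK y (fun w => f (Φ (y, w)).2)
        ((hf.comp measurable_snd).comp (hΦ.comp measurable_prodMk_left))]
    refine lintegral_congr fun x' => ?_
    have hm : Measurable fun z => f (M.r y + M.γ * z) :=
      hf.comp ((measurable_id.const_mul _).const_add _)
    rw [← hK2, Measure.snd, lintegral_map hm measurable_snd]
  · rw [hc' y _ (measurable_edist_rpow p)]
    have hpt : ∀ w : S × (ℝ × ℝ), edist (Φ (y, w)).1 (Φ (y, w)).2
        ≤ ENNReal.ofReal M.γ * edist w.2.1 w.2.2 + ENNReal.ofReal (M.γ * k) := by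
      intro w
      have e : (Φ (y, w)).1 - (Φ (y, w)).2
          = M.γ * (w.2.1 - w.2.2) + -(M.γ * (τ * klFn π πref w.1)) := by
        simp only [Φ]; ring
      rw [edist_eq_enorm_sub, e, edist_eq_enorm_sub]
      refine (enorm_add_le _ _).trans (add_le_add ?_ ?_)
      · rw [enorm_mul, Real.enorm_of_nonneg M.γ_pos.le]
      · rw [enorm_neg, Real.enorm_of_nonneg (mul_nonneg M.γ_pos.le
          (mul_nonneg hτ (klFn_nonneg πref π w.1)))]
        exact ENNReal.ofReal_le_ofReal (mul_le_mul_of_nonneg_left (hkle _) M.γ_pos.le)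
    have hed : Measurable fun w : S × (ℝ × ℝ) => edist w.2.1 w.2.2 :=
      measurable_edist.comp measurable_snd
    refine (lintegral_mono fun w => ENNReal.rpow_le_rpow (hpt w) hp0.le).trans
      (lintegral_add_rpow_le hp (hed.const_mul _).aemeasurable aemeasurable_const ?_ (by simp))
    simp_rw [ENNReal.mul_rpow_of_nonneg _ _ hp0.le]
    rw [lintegral_const_mul _ (hed.pow_const p)]
    gcongr
    rw [hPK y (fun w => edist w.2.1 w.2.2 ^ p) (hed.pow_const p)]
    calc _ ≤ ∫⁻ _, D ^ p ∂(M.P y) := lintegral_mono fun x' => hKd x'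
      _ = D ^ p := by simp

end Coupling

/-! ### Mixtures of Boltzmann-Gibbs policies -/

section Mixture

variable (πref : Kernel S A) [IsMarkovKernel πref] {τ : ℝ}

/-- One `e` in the exponent comes from the action values, the other from the soft values, which move
by at most as much. -/
theorem mul_gibbs_le_gibbs {q q' : S × A → ℝ} (hq : IsBddMeas q) (hq' : IsBddMeas q')
    (hτ : 0 < τ) {e : ℝ} (he : ∀ y, |q y - q' y| ≤ e) (x : S) (a : A) :
    Real.exp (-(2 * e / τ)) * gibbs πref τ q' x a ≤ gibbs πref τ q x a := by
  rw [gibbs, gibbs, ← Real.exp_add, Real.exp_le_exp, ← neg_div, ← add_div]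
  have h1 := abs_le.1 (he (x, a))
  have h2 := abs_le.1 (softValue_abs_sub_le πref hq hq' hτ he x)
  gcongr
  linarith [h1.1, h2.2]

/-- A Boltzmann-Gibbs policy is a mixture with any other one, the weight of which is close to `1`
if the two action-value functions are close. -/
theorem exists_boltzmann_mixture {q q' : S × A → ℝ} (hq : IsBddMeas q) (hq' : IsBddMeas q')
    (hτ : 0 < τ) {e : ℝ} (he : ∀ y, |q y - q' y| ≤ e) :
    ∃ Q R : Kernel S A, IsFiniteKernel Q ∧ IsFiniteKernel R ∧
      (∀ x, boltzmann πref τ q x = Q x + R x) ∧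
      ∀ x, Q x = ENNReal.ofReal (Real.exp (-(2 * e / τ))) • boltzmann πref τ q' x := by
  set s := Real.exp (-(2 * e / τ))
  have := isMarkovKernel_boltzmann πref hq hτ
  have hm1 : Measurable (Function.uncurry fun x a =>
      ENNReal.ofReal (s * gibbs πref τ q' x a)) :=
    ((measurable_gibbs πref hq').const_mul s).ennreal_ofReal
  have hm2 : Measurable (Function.uncurry fun x a =>
      ENNReal.ofReal (gibbs πref τ q x a - s * gibbs πref τ q' x a)) :=
    ((measurable_gibbs πref hq).sub ((measurable_gibbs πref hq').const_mul s)).ennreal_ofReal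
  set Q := πref.withDensity fun x a => ENNReal.ofReal (s * gibbs πref τ q' x a)
  set R := πref.withDensity fun x a =>
    ENNReal.ofReal (gibbs πref τ q x a - s * gibbs πref τ q' x a)
  have hsum : ∀ x, boltzmann πref τ q x = Q x + R x := fun x => by
    rw [boltzmann_apply πref hq, Kernel.withDensity_apply _ hm1, Kernel.withDensity_apply _ hm2,
      ← withDensity_add_left (f := fun a => ENNReal.ofReal (s * gibbs πref τ q' x a))
        (hm1.comp measurable_prodMk_left)]
    congr 1
    ext a
    have h1 := mul_gibbs_le_gibbs πref hq hq' hτ he x a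
    have h2 : 0 ≤ s * gibbs πref τ q' x a :=
      mul_nonneg (Real.exp_pos _).le (gibbs_pos πref q' x a).le
    rw [Pi.add_apply]
    change _ = ENNReal.ofReal _ + ENNReal.ofReal _
    rw [← ENNReal.ofReal_add h2 (sub_nonneg.2 h1), add_sub_cancel]
  refine ⟨Q, R, ⟨1, ENNReal.one_lt_top, fun x => ?_⟩, ⟨1, ENNReal.one_lt_top, fun x => ?_⟩, hsum,
    fun x => ?_⟩
  · rw [← measure_univ (μ := boltzmann πref τ q x), hsum x, Measure.add_apply]
    exact le_self_add
  · rw [← measure_univ (μ := boltzmann πref τ q x), hsum x, Measure.add_apply]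
    exact le_add_self
  · rw [boltzmann_apply πref hq', Kernel.withDensity_apply _ hm1, ← withDensity_smul
      (f := fun a => ENNReal.ofReal (gibbs πref τ q' x a)) _ ((measurable_ofReal_gibbs πref hq').comp measurable_prodMk_left)]
    congr 1
    ext a
    rw [Pi.smul_apply, smul_eq_mul, ENNReal.ofReal_mul (Real.exp_pos _).le]

end Mixture

/-! ### Means of soft distributional Bellman iterates -/

section Means

variable (M : MDP S A) (πref : Kernel S A) [IsMarkovKernel πref] {τ : ℝ}

/-- Probability kernels with uniformly bounded first moments. -/
def BddMean (ς : Kernel (S × A) ℝ) : Prop :=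
  IsMarkovKernel ς ∧ ∃ C : ℝ, ∀ y, ∫⁻ z, ‖z‖ₑ ∂(ς y) ≤ ENNReal.ofReal C

theorem BddMean.integrable {ς : Kernel (S × A) ℝ} (h : BddMean ς) (y : S × A) :
    Integrable (fun z => z) (ς y) := by
  obtain ⟨-, C, hC⟩ := h
  exact ⟨aestronglyMeasurable_id, (hC y).trans_lt ENNReal.ofReal_lt_top⟩

theorem BddMean.isBddMeas {ς : Kernel (S × A) ℝ} (h : BddMean ς) : IsBddMeas (meanQ ς) := by
  have hM := h.1
  obtain ⟨-, C, hC⟩ := h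
  refine ⟨(StronglyMeasurable.integral_kernel (κ := ς)
    measurable_id.stronglyMeasurable).measurable, max C 0, fun y => ?_⟩
  have h1 : ‖∫ z, z ∂(ς y)‖ₑ ≤ ENNReal.ofReal C := (enorm_integral_le_lintegral_enorm _).trans (hC y)
  rw [Real.enorm_eq_ofReal_abs] at h1
  by_cases hC0 : 0 ≤ C
  · exact ((ENNReal.ofReal_le_ofReal_iff hC0).1 h1).trans (le_max_left _ _)
  · rw [ENNReal.ofReal_of_nonpos (not_le.1 hC0).le] at h1
    exact (ENNReal.ofReal_eq_zero.1 (le_antisymm h1 zero_le)).trans (le_max_right _ _)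

theorem bddMean_of_hasBoundedMoments {p : ℝ} (hp : 1 ≤ p) {ς : Kernel (S × A) ℝ}
    [IsMarkovKernel ς] (h : HasBoundedMoments p ς) : BddMean ς := by
  refine ⟨inferInstance, (1 + ⨆ y, ∫⁻ z, ‖z‖ₑ ^ p ∂(ς y)).toReal, fun y => ?_⟩
  rw [ENNReal.ofReal_toReal (ENNReal.add_ne_top.2 ⟨ENNReal.one_ne_top, h.ne⟩)]
  have hle : ∀ x : ℝ≥0∞, x ≤ 1 + x ^ p := fun x => by
    rcases le_total x 1 with hx | hx
    · exact hx.trans le_self_add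
    · calc x = x ^ (1 : ℝ) := (ENNReal.rpow_one x).symm
        _ ≤ x ^ p := ENNReal.rpow_le_rpow_of_exponent_le hx hp
        _ ≤ _ := le_add_self
  calc ∫⁻ z, ‖z‖ₑ ∂(ς y) ≤ ∫⁻ z, (1 + ‖z‖ₑ ^ p) ∂(ς y) := lintegral_mono fun z => hle _
    _ = 1 + ∫⁻ z, ‖z‖ₑ ^ p ∂(ς y) := by
      rw [lintegral_add_left measurable_const]; simp
    _ ≤ _ := add_le_add le_rfl (le_iSup (fun y => ∫⁻ z, ‖z‖ₑ ^ p ∂(ς y)) y)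

theorem exists_klFn_boltzmann_le {q : S × A → ℝ} (hq : IsBddMeas q) (hτ : 0 < τ) :
    ∃ k : ℝ, ∀ x, τ * klFn (boltzmann πref τ q) πref x ≤ k := by
  obtain ⟨C, hC⟩ := hq.2
  refine ⟨2 * C, fun x => mul_klFn_boltzmann_le πref hq hτ x (ae_of_all _ fun a => ?_)⟩
  linarith [(abs_le.1 (hC (x, a))).2, (abs_le.1 (softValue_abs_le πref hq hτ hC x)).1]

/-- Keeps the means bounded along the iteration, so that every Boltzmann-Gibbs policy met is a
probability kernel. -/
theorem bddMean_softDistBellmanOpt (hτ : 0 < τ) {ς : Kernel (S × A) ℝ} (h : BddMean ς) :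
    BddMean (softDistBellmanOpt M πref τ ς) := by
  have hq := h.isBddMeas
  have := isMarkovKernel_boltzmann πref hq hτ
  have hM := h.1
  have hk := measurable_klFn_boltzmann πref hq hτ
  obtain ⟨k, hkle⟩ := exists_klFn_boltzmann_le πref hq hτ
  obtain ⟨R, hR⟩ := M.bounded_r
  obtain ⟨-, C, hC⟩ := h
  rw [softDistBellmanOpt]
  refine ⟨isMarkovKernel_softDistBellman M πref τ _ hk ς,
    (ENNReal.ofReal R + ENNReal.ofReal M.γ * ENNReal.ofReal C
      + ENNReal.ofReal (M.γ * k)).toReal, fun y => ?_⟩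
  rw [ENNReal.ofReal_toReal (by finiteness), lintegral_softDistBellman M πref τ _ hk ς y
    measurable_enorm]
  set π := boltzmann πref τ (meanQ ς)
  have hpt : ∀ x z, ‖M.r y + M.γ * z - M.γ * τ * klFn π πref x‖ₑ
      ≤ ENNReal.ofReal R + ENNReal.ofReal M.γ * ‖z‖ₑ + ENNReal.ofReal (M.γ * k) := fun x z => by
    refine enorm_sub_le.trans (add_le_add ((enorm_add_le _ _).trans (add_le_add ?_ ?_)) ?_)
    · rw [Real.enorm_eq_ofReal_abs]; exact ENNReal.ofReal_le_ofReal (hR y)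
    · rw [enorm_mul, Real.enorm_of_nonneg M.γ_pos.le]
    · rw [mul_assoc, Real.enorm_of_nonneg (mul_nonneg M.γ_pos.le
        (mul_nonneg hτ.le (klFn_nonneg πref π x)))]
      exact ENNReal.ofReal_le_ofReal (mul_le_mul_of_nonneg_left (hkle _) M.γ_pos.le)
  have hav : ∀ x, ∫⁻ z, ‖z‖ₑ ∂(actionAvg π ς x) ≤ ENNReal.ofReal C := fun x => by
    rw [lintegral_actionAvg π ς x measurable_enorm]
    calc _ ≤ ∫⁻ _, ENNReal.ofReal C ∂(π x) := lintegral_mono fun a => hC (x, a)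
      _ = _ := by simp
  calc _ ≤ ∫⁻ x', ∫⁻ z, (ENNReal.ofReal R + ENNReal.ofReal M.γ * ‖z‖ₑ + ENNReal.ofReal (M.γ * k))
        ∂(actionAvg π ς x') ∂(M.P y) := lintegral_mono fun x' => lintegral_mono fun z => hpt x' z
    _ ≤ ∫⁻ _, (ENNReal.ofReal R + ENNReal.ofReal M.γ * ENNReal.ofReal C
        + ENNReal.ofReal (M.γ * k)) ∂(M.P y) := by
      refine lintegral_mono fun x' => ?_
      simp only
      rw [lintegral_add_right _ measurable_const, lintegral_add_left measurable_const,
        lintegral_const_mul _ measurable_enorm]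
      simp only [lintegral_const, measure_univ, mul_one]
      gcongr
      exact hav x'
    _ = _ := by simp

theorem integral_affine {Ω : Type*} [MeasurableSpace Ω] {μ : Measure Ω} [IsProbabilityMeasure μ]
    {f : Ω → ℝ} (hf : Integrable f μ) (a b c : ℝ) :
    ∫ z, (a + b * f z - c) ∂μ = a + b * ∫ z, f z ∂μ - c := by
  have h : Integrable (fun z => a + b * f z) μ := (integrable_const a).add (hf.const_mul b)
  rw [integral_sub h (integrable_const c), integral_add (integrable_const a) (hf.const_mul b),
    integral_const_mul]
  simp

/-- On means, the soft distributional optimality operator is the soft Bellman optimality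
operator. -/
theorem meanQ_softDistBellmanOpt (hτ : 0 < τ) {ς : Kernel (S × A) ℝ} (h : BddMean ς) :
    meanQ (softDistBellmanOpt M πref τ ς) = softBellmanOpt M πref τ (meanQ ς) := by
  have hq := h.isBddMeas
  have := isMarkovKernel_boltzmann πref hq hτ
  have hM := h.1
  have hk := measurable_klFn_boltzmann πref hq hτ
  obtain ⟨k, hkle⟩ := exists_klFn_boltzmann_le πref hq hτ
  obtain ⟨C, hC⟩ := hq.2
  funext y
  have hb := measurable_softBackup M hk τ
  have hint := (bddMean_softDistBellmanOpt M πref hτ h).integrable y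
  -- With the soft value written as mean minus penalty, both sides have the same integrand, and the
  -- rest is Fubini.
  rw [softBellmanOpt_eq πref M hq hτ, meanQ]
  rw [softDistBellmanOpt, softDistBellman, Kernel.map_apply _ hb, Kernel.prod_apply,
    Kernel.id_apply, Measure.dirac_prod, Measure.map_map hb measurable_prodMk_left] at hint ⊢
  have hb2 := hb.comp (measurable_prodMk_left (x := y))
  set π := boltzmann πref τ (meanQ ς)
  have hint2 := (integrable_map_measure aestronglyMeasurable_id hb2.aemeasurable).1 hint
  rw [integral_map hb2.aemeasurable (f := fun z => z) aestronglyMeasurable_id]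
  simp only [Function.comp_def, id] at hint2 ⊢
  have hkb : ∀ x, |M.γ * τ * klFn π πref x| ≤ M.γ * k := fun x => by
    rw [mul_assoc, abs_of_nonneg (mul_nonneg M.γ_pos.le
      (mul_nonneg hτ.le (klFn_nonneg πref π x)))]
    exact mul_le_mul_of_nonneg_left (hkle _) M.γ_pos.le
  have e1 : ∀ y' : S × A, ∫ z, (M.r y + M.γ * z - M.γ * τ * klFn π πref y'.1) ∂(ς y')
      = M.r y + M.γ * meanQ ς y' - M.γ * τ * klFn π πref y'.1 := fun y' => by
    have hi := h.integrable y'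
    rw [integral_affine hi, meanQ]
  rw [integral_compProd hint2]
  simp only [Kernel.prodMkLeft_apply, e1]
  have hq1 : Measurable fun y' : S × A => M.r y + M.γ * meanQ ς y' := (hq.1.const_mul _).const_add _
  have hk1 : Measurable fun y' : S × A => M.γ * τ * klFn π πref y'.1 :=
    (hk.comp measurable_fst).const_mul _
  have hi3 : Integrable (fun y' : S × A => M.r y + M.γ * meanQ ς y' - M.γ * τ * klFn π πref y'.1)
      (step M π y) :=
    ((integrable_const _).add ((integrable_of_abs_le hq.1 hC).const_mul _)).sub
      (integrable_of_abs_le hk1 fun y' => hkb y'.1)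
  have e2 : ∀ x' : S, ∫ a', (M.r y + M.γ * meanQ ς (x', a') - M.γ * τ * klFn π πref x') ∂(π x')
      = M.r y + M.γ * (∫ a', meanQ ς (x', a') ∂(π x') - τ * klFn π πref x') := fun x' => by
    have hi : Integrable (fun a' => meanQ ς (x', a')) (π x') :=
      integrable_of_abs_le (hq.section_measurable x') fun a => hC _
    rw [integral_affine hi]
    ring
  unfold step at hi3 ⊢
  rw [integral_compProd hi3]
  simp only [Kernel.prodMkLeft_apply, e2]
  have hm4 : Measurable fun x' => ∫ a', meanQ ς (x', a') ∂(π x') - τ * klFn π πref x' :=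
    (StronglyMeasurable.integral_kernel_prod_right' (κ := π) hq.1.stronglyMeasurable).measurable.sub
      (hk.const_mul _)
  have hi4 : Integrable (fun x' => ∫ a', meanQ ς (x', a') ∂(π x') - τ * klFn π πref x')
      (M.P y) := by
    refine integrable_of_abs_le hm4 (C := C + k) fun x => (abs_sub _ _).trans (add_le_add
      (integral_abs_le fun a => hC _) ?_)
    rw [abs_of_nonneg (mul_nonneg hτ.le (klFn_nonneg πref π x))]
    exact hkle x
  rw [integral_add (integrable_const _) (hi4.const_mul _), integral_const_mul]
  simp

end Means

/-! ### Reference-optimality -/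

section Optimality

variable (M : MDP S A) (πref : Kernel S A) [IsMarkovKernel πref] {τ : ℝ}

/-- The Boltzmann-Gibbs policy of an approximation of `q*_τ` has a value at least `q*_τ`, up to a
multiple of the error. -/
theorem qSoftStar_sub_le_qValue (hτ : 0 < τ) {q : S × A → ℝ} (hq : IsBddMeas q) {e : ℝ}
    (he : ∀ y, |q y - qSoftStar M πref τ y| ≤ e) (y : S × A) :
    qSoftStar M πref τ y - M.γ * (2 * e) / (1 - M.γ) ≤ qValue M (boltzmann πref τ q) y := by
  have := isMarkovKernel_boltzmann πref hq hτ
  obtain ⟨hs, hfix⟩ := qSoftStar_spec M πref hτ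
  set π := boltzmann πref τ q
  set qs := qSoftStar M πref τ
  have hv := isBddMeas_qValue M π
  obtain ⟨B, hB⟩ := hv.2
  obtain ⟨B', hB'⟩ := hs.2
  obtain ⟨B'', hB''⟩ := hq.2
  suffices h : -(M.γ * (2 * e) / (1 - M.γ)) ≤ qValue M π y - qs y by linarith
  refine lower_bound_of_contraction M.γ_pos.le M.γ_lt_one (fun y => qValue M π y - qs y)
    ⟨B + B', fun y => (abs_sub _ _).trans (add_le_add (hB y) (hB' y))⟩ (fun C hC y => ?_) y
  have hVi : Integrable (softValue πref τ qs) (M.P y) :=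
    integrable_of_abs_le (measurable_softValue πref hs) (softValue_abs_le πref hs hτ hB')
  have hvi : Integrable (fun x' => ∫ a', qValue M π (x', a') ∂(π x')) (M.P y) :=
    integrable_of_abs_le (StronglyMeasurable.integral_kernel_prod_right' (κ := π)
      hv.1.stronglyMeasurable).measurable fun x => integral_abs_le fun a => hB _
  -- One `e` is paid to replace `q*_τ` by `q` in the soft value and one to return from `q` to `q*_τ`
  -- under `π`. In between, the nonnegative penalty is dropped.
  have hpt : ∀ x, softValue πref τ qs x ≤ ∫ a', qValue M π (x, a') ∂(π x) + (C + 2 * e) := by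
    intro x
    have h1 := softValue_le_add πref hs hq hτ (C := e)
      (fun y => by linarith [(abs_le.1 (he y)).1]) x
    have h2 := mul_klFn_boltzmann πref hq hτ x
    have h3 := mul_nonneg hτ.le (klFn_nonneg πref π x)
    have h4 : ∫ a, q (x, a) ∂(π x) ≤ ∫ a, qValue M π (x, a) ∂(π x) + (C + e) :=
      integral_le_integral_add (integrable_of_abs_le (hq.section_measurable x) fun a => hB'' _)
        (integrable_of_abs_le (hv.section_measurable x) fun a => hB _) fun a => by
          linarith [(abs_le.1 (he (x, a))).2, hC (x, a)]
    linarith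
  have hint := integral_le_integral_add hVi hvi hpt
  have e1 := qValue_eq M π y
  have e2 : qs y = M.r y + M.γ * ∫ x', softValue πref τ qs x' ∂(M.P y) := (congrFun hfix y).symm
  rw [e1, e2]
  have := mul_le_mul_of_nonneg_left hint M.γ_pos.le
  linarith

/-- If the soft value of `q*_τ` is within `k` of its essential supremum, then `q*_τ` is nearly
reference-optimal. -/
theorem qRefStar_sub_le_qSoftStar (hτ : 0 < τ) {k : ℝ}
    (hk : ∀ x, essSup (fun a => qSoftStar M πref τ (x, a)) (πref x)
      ≤ softValue πref τ (qSoftStar M πref τ) x + k) (y : S × A) :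
    qRefStar M πref y - M.γ * k / (1 - M.γ) ≤ qSoftStar M πref τ y := by
  obtain ⟨hs, hfix⟩ := qSoftStar_spec M πref hτ
  obtain ⟨hr, hfix'⟩ := qRefStar_spec M πref
  set qs := qSoftStar M πref τ
  set qr := qRefStar M πref
  obtain ⟨B, hB⟩ := hs.2
  obtain ⟨B', hB'⟩ := hr.2
  suffices h : -(M.γ * k / (1 - M.γ)) ≤ qs y - qr y by linarith
  refine lower_bound_of_contraction M.γ_pos.le M.γ_lt_one (fun y => qs y - qr y)
    ⟨B + B', fun y => (abs_sub _ _).trans (add_le_add (hB y) (hB' y))⟩ (fun C hC y => ?_) y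
  have hVi : Integrable (softValue πref τ qs) (M.P y) :=
    integrable_of_abs_le (measurable_softValue πref hs) (softValue_abs_le πref hs hτ hB)
  have hei : Integrable (fun x' => essSup (fun a' => qr (x', a')) (πref x')) (M.P y) :=
    integrable_of_abs_le (measurable_essSup πref hr) fun x => essSup_abs_le fun a => hB' _
  have hpt : ∀ x, essSup (fun a' => qr (x, a')) (πref x)
      ≤ softValue πref τ qs x + (C + k) := by
    intro x
    have := essSup_le_add (μ := πref x) (f := fun a => qr (x, a)) (g := fun a => qs (x, a))
      (fun a => hB' _) (fun a => hB _) (C := C) fun a => by linarith [hC (x, a)]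
    linarith [hk x]
  have hint := integral_le_integral_add hei hVi hpt
  have e1 : qs y = M.r y + M.γ * ∫ x', softValue πref τ qs x' ∂(M.P y) := (congrFun hfix y).symm
  have e2 : qr y = M.r y + M.γ * ∫ x', essSup (fun a' => qr (x', a')) (πref x') ∂(M.P y) :=
    (congrFun hfix' y).symm
  rw [e1, e2]
  have := mul_le_mul_of_nonneg_left hint M.γ_pos.le
  linarith

/-- The coverage assumption bounds the gap between essential suprema and soft values. -/
theorem Coverage.exists_essSup_le (h : Coverage M πref) : ∃ L : ℝ, 0 ≤ L ∧
    ∀ τ, 0 < τ → ∀ x, essSup (fun a => qSoftStar M πref τ (x, a)) (πref x)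
      ≤ softValue πref τ (qSoftStar M πref τ) x + τ * L := by
  obtain ⟨c, hc, hle⟩ := h
  -- The maximum with `0` makes `L` nonnegative without first proving `c ≤ 1`.
  refine ⟨max (Real.log (1 / c)) 0, le_max_right _ _, fun τ hτ x => ?_⟩
  refine (essSup_le_softValue_add πref (qSoftStar_spec M πref hτ).1 hτ x hc
    (hle.trans ((iInf₂_le τ hτ).trans (iInf_le _ x)))).trans ?_
  gcongr
  exact le_max_left _ _

/-- The divergence of the Boltzmann-Gibbs policy of an approximation of `q*_τ`. -/
theorem mul_klFn_boltzmann_le_of_approx (hτ : 0 < τ) {k : ℝ}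
    (hk : ∀ x, essSup (fun a => qSoftStar M πref τ (x, a)) (πref x)
      ≤ softValue πref τ (qSoftStar M πref τ) x + k)
    {q : S × A → ℝ} (hq : IsBddMeas q) {e : ℝ}
    (he : ∀ y, |q y - qSoftStar M πref τ y| ≤ e) (x : S) :
    τ * klFn (boltzmann πref τ q) πref x ≤ k + 2 * e := by
  obtain ⟨hs, -⟩ := qSoftStar_spec M πref hτ
  obtain ⟨B, hB⟩ := hs.2
  refine mul_klFn_boltzmann_le πref hq hτ x ?_
  filter_upwards [ae_le_essSup_of_abs_le (μ := πref x)
    (f := fun a => qSoftStar M πref τ (x, a)) fun a => hB _] with a ha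
  have h1 := (abs_le.1 (he (x, a))).2
  have h2 := softValue_le_add πref hs hq hτ (C := e)
    (fun y => by linarith [(abs_le.1 (he y)).1]) x
  linarith [hk x]

end Optimality

/-! ### Comparison of soft and unregularized returns -/

section SoftReturns

variable (M : MDP S A) (πref : Kernel S A) {τ : ℝ}

/-- Removing the divergence penalty moves the return distribution little. -/
theorem wass_softReturnDist_le {p : ℝ} (hp : 1 ≤ p) (hτ : 0 < τ) {π : Kernel S A}
    [IsMarkovKernel π] (hm : Measurable (klFn π πref)) {k : ℝ}
    (hk : ∀ x, τ * klFn π πref x ≤ k) (y : S × A) :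
    wass p (softReturnDist M πref τ π y) (returnDist M π y)
      ≤ ENNReal.ofReal (M.γ * k / (1 - M.γ)) := by
  have hp0 : 0 ≤ p := by linarith
  obtain ⟨R, hR⟩ := M.bounded_r
  set F : (ℕ → S × A) → ℝ := fun w => M.r (w 0) +
      ∑' t : ℕ, M.γ ^ (t + 1) * (M.r (w (t + 1)) - τ * klFn π πref (w (t + 1)).1)
  have hF : Measurable F := by
    refine (M.measurable_r.comp (measurable_pi_apply 0)).add ?_
    have h : ∀ t : ℕ, Measurable fun w : ℕ → S × A =>
        M.γ ^ (t + 1) * (M.r (w (t + 1)) - τ * klFn π πref (w (t + 1)).1) := fun t =>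
      ((M.measurable_r.comp (measurable_pi_apply _)).sub
        ((hm.comp (measurable_fst.comp (measurable_pi_apply (t + 1)))).const_mul _)).const_mul _
    exact Measurable.tsum h
  have hG := measurable_discountedReturn M
  have hkn : ∀ x, |τ * klFn π πref x| ≤ k := fun x => by
    rw [abs_of_nonneg (mul_nonneg hτ.le (klFn_nonneg πref π x))]; exact hk x
  have hdiff : ∀ w, |F w - discountedReturn M w| ≤ M.γ * k / (1 - M.γ) := by
    intro w
    have s1 := summable_discounted M.γ_pos.le M.γ_lt_one (f := fun t => M.r (w t)) fun t => hR _
    have s2 := summable_discounted M.γ_pos.le M.γ_lt_one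
      (f := fun t => M.r (w (t + 1))) fun t => hR _
    have s3 := summable_discounted M.γ_pos.le M.γ_lt_one
      (f := fun t => τ * klFn π πref (w (t + 1)).1) fun t => hkn _
    have e1 : ∑' t : ℕ, M.γ ^ (t + 1) * (M.r (w (t + 1)) - τ * klFn π πref (w (t + 1)).1)
        = M.γ * ∑' t : ℕ, M.γ ^ t * M.r (w (t + 1))
          - M.γ * ∑' t : ℕ, M.γ ^ t * (τ * klFn π πref (w (t + 1)).1) := by
      rw [← mul_sub, ← s2.tsum_sub s3, ← tsum_mul_left]
      exact tsum_congr fun t => by ring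
    have e2 : discountedReturn M w
        = M.r (w 0) + M.γ * ∑' t : ℕ, M.γ ^ t * M.r (w (t + 1)) := by
      rw [discountedReturn, s1.tsum_eq_zero_add, ← tsum_mul_left]
      simp only [pow_zero, one_mul]
      congr 1
      exact tsum_congr fun t => by ring
    -- The penalty starts at time `1`, whence the extra factor `γ`.
    have e3 : F w - discountedReturn M w
        = -(M.γ * ∑' t : ℕ, M.γ ^ t * (τ * klFn π πref (w (t + 1)).1)) := by
      simp only [F]
      rw [e1, e2]; ring
    rw [e3, abs_neg, abs_mul, abs_of_pos M.γ_pos, mul_div_assoc]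
    exact mul_le_mul_of_nonneg_left
      (abs_tsum_discounted_le M.γ_pos.le M.γ_lt_one fun t => hkn _) M.γ_pos.le
  have hFG : Measurable fun w => (F w, discountedReturn M w) := hF.prodMk hG
  -- Both returns are read off the same trajectory, where they differ by a deterministic bound.
  refine wass_le_of_coupling hp ((chain (step M π) y).map fun w => (F w, discountedReturn M w))
    ?_ ?_ ?_
  · rw [Measure.fst, Measure.map_map measurable_fst hFG, softReturnDist, dif_pos ‹_›,
      Kernel.map_apply _ hF]
    rfl
  · rw [Measure.snd, Measure.map_map measurable_snd hFG, returnDist_eq, Kernel.map_apply _ hG]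
    rfl
  · rw [lintegral_map (measurable_edist_rpow p) hFG]
    calc _ ≤ ∫⁻ _, ENNReal.ofReal (M.γ * k / (1 - M.γ)) ^ p ∂(chain (step M π) y) := by
          refine lintegral_mono fun w => ENNReal.rpow_le_rpow ?_ hp0
          rw [edist_dist, Real.dist_eq]
          exact ENNReal.ofReal_le_ofReal (hdiff w)
      _ = _ := by simp

end SoftReturns

/-! ### Convergence of the control iterates -/

/-- The limiting map `D ↦ γ D + g` has fixed point `g / (1 - γ)`. For `m` strictly between it and
`l`, eventually `b n * m + h n ≤ m` and `b n ≤ β < 1`, so the excess of `D n` over `m` decays like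
`β ^ j`. -/
theorem eventually_le_of_perturbed_contraction {γ g l : ℝ} (hγ1 : γ < 1) {b h D : ℕ → ℝ}
    (hb0 : ∀ n, 0 ≤ b n) (hb : Tendsto b atTop (𝓝 γ)) (hh : Tendsto h atTop (𝓝 g))
    (hD : ∀ n, D (n + 1) ≤ b n * D n + h n) (hl : g / (1 - γ) < l) :
    ∀ᶠ n in atTop, D n ≤ l := by
  have h1 : 0 < 1 - γ := by linarith
  obtain ⟨m, hm1, hm2⟩ := exists_between hl
  obtain ⟨β, hβ1, hβ2⟩ := exists_between hγ1
  have hγ0 : 0 ≤ γ := ge_of_tendsto' hb hb0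
  have hlim : Tendsto (fun n => b n * m + h n) atTop (𝓝 (γ * m + g)) := (hb.mul_const m).add hh
  have hlt : γ * m + g < m := by
    rw [div_lt_iff₀ h1] at hm1; linarith
  obtain ⟨N, hN⟩ := eventually_atTop.1
    ((hlim.eventually (eventually_le_nhds hlt)).and (hb.eventually (eventually_le_nhds hβ1)))
  have key : ∀ j, max (D (N + j) - m) 0 ≤ β ^ j * max (D N - m) 0 := by
    intro j
    induction j with
    | zero => simp
    | succ j ih =>
      obtain ⟨c1, c2⟩ := hN (N + j) (Nat.le_add_right _ _)
      have hβ0 : 0 ≤ β := hγ0.trans hβ1.le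
      have e0 : 0 ≤ max (D (N + j) - m) 0 := le_max_right _ _
      refine max_le ?_ (mul_nonneg (by positivity) (le_max_right _ _))
      have i1 := hD (N + j)
      have i2 : b (N + j) * (D (N + j) - m) ≤ β * max (D (N + j) - m) 0 :=
        (mul_le_mul_of_nonneg_left (le_max_left _ _) (hb0 _)).trans
          (mul_le_mul_of_nonneg_right c2 e0)
      have i3 := mul_le_mul_of_nonneg_left ih hβ0
      rw [← add_assoc, pow_succ']
      linarith
  have hz : Tendsto (fun j : ℕ => β ^ j * max (D N - m) 0) atTop (𝓝 0) := by
    simpa using (tendsto_pow_atTop_nhds_zero_of_lt_one (hγ0.trans hβ1.le) hβ2).mul_const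
      (max (D N - m) 0)
  obtain ⟨J, hJ⟩ := eventually_atTop.1 (hz.eventually (eventually_le_nhds (sub_pos.2 hm2)))
  refine eventually_atTop.2 ⟨N + J, fun n hn => ?_⟩
  obtain ⟨j, rfl⟩ := Nat.exists_eq_add_of_le ((Nat.le_add_right N J).trans hn)
  have := (le_max_left _ _).trans ((key j).trans (hJ j (by omega)))
  linarith

section Iterates

variable (M : MDP S A) (πref : Kernel S A) [IsMarkovKernel πref] {τ : ℝ}

/-- The control iterates start at the image of `ζ`, not at `ζ`, hence the shift by one. -/
theorem controlIter_eq_iterate (ζ : Kernel (S × A) ℝ) (n : ℕ) :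
    controlIter M πref τ ζ n = (softDistBellmanOpt M πref τ)^[n + 1] ζ := by
  induction n with
  | zero => rfl
  | succ n ih => rw [controlIter, ih, Function.iterate_succ_apply' (n := n + 1)]

theorem BddMean.iterate (hτ : 0 < τ) {ζ : Kernel (S × A) ℝ} (h : BddMean ζ) (n : ℕ) :
    BddMean ((softDistBellmanOpt M πref τ)^[n] ζ) := by
  induction n with
  | zero => exact h
  | succ n ih =>
    rw [Function.iterate_succ_apply']
    exact bddMean_softDistBellmanOpt M πref hτ ih

/-- The means evolve by themselves under the contraction, whatever else happens to the
distributions. -/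
theorem exists_meanQ_iterate_abs_sub_le (hτ : 0 < τ) {ζ : Kernel (S × A) ℝ} (h : BddMean ζ) :
    ∃ E : ℝ, 0 ≤ E ∧ ∀ n y, |meanQ ((softDistBellmanOpt M πref τ)^[n] ζ) y - qSoftStar M πref τ y|
      ≤ M.γ ^ n * E := by
  obtain ⟨hs, hfix⟩ := qSoftStar_spec M πref hτ
  obtain ⟨B, hB⟩ := h.isBddMeas.2
  obtain ⟨B', hB'⟩ := hs.2
  refine ⟨|B| + |B'|, by positivity, fun n => ?_⟩
  induction n with
  | zero =>
    intro y
    rw [pow_zero, one_mul]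
    exact (abs_sub _ _).trans (add_le_add ((hB y).trans (le_abs_self _))
      ((hB' y).trans (le_abs_self _)))
  | succ n ih =>
    intro y
    rw [Function.iterate_succ_apply', meanQ_softDistBellmanOpt M πref hτ (h.iterate M πref hτ n),
      ← hfix, pow_succ', mul_assoc]
    refine softBellmanOpt_abs_sub_le M πref hτ (h.iterate M πref hτ n).isBddMeas hs ?_ y
    exact ih

/-- The control iterates stay coupled with the return distribution of `π^{τ,*}`, the cost being
governed by a perturbed contraction. -/
theorem exists_hasCoupling_iterate (hτ : 0 < τ) {p : ℝ} (hp : 1 ≤ p) {k : ℝ} (hk0 : 0 ≤ k)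
    (hk : ∀ x, essSup (fun a => qSoftStar M πref τ (x, a)) (πref x)
      ≤ softValue πref τ (qSoftStar M πref τ) x + k)
    {ζ : Kernel (S × A) ℝ} [IsMarkovKernel ζ] (hζ : HasBoundedMoments p ζ) {l : ℝ}
    (hl : M.γ * k / (1 - M.γ) < l) :
    ∀ᶠ n in atTop, HasCoupling p ((softDistBellmanOpt M πref τ)^[n] ζ)
      (returnDist M (piStar M πref τ)) (ENNReal.ofReal l) := by
  have hp0 : 0 < p := by linarith
  obtain ⟨hs, -⟩ := qSoftStar_spec M πref hτ
  have hπM : IsMarkovKernel (piStar M πref τ) := isMarkovKernel_boltzmann πref hs hτ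
  have hgood := bddMean_of_hasBoundedMoments hp hζ
  obtain ⟨E, hE0, hE⟩ := exists_meanQ_iterate_abs_sub_le M πref hτ hgood
  obtain ⟨R, hR⟩ := M.bounded_r
  set C := |R / (1 - M.γ)|
  have hCae : ∀ y, ∀ᵐ z ∂(returnDist M (piStar M πref τ) y), |z| ≤ C := fun y => by
    filter_upwards [returnDist_abs_le M (piStar M πref τ) hR y] with z hz
    exact hz.trans (le_abs_self _)
  have hCe : ∀ y, ∀ᵐ z ∂(returnDist M (piStar M πref τ) y), ‖z‖ₑ ≤ ENNReal.ofReal C := fun y => by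
    filter_upwards [hCae y] with z hz
    rw [Real.enorm_eq_ofReal_abs]
    exact ENNReal.ofReal_le_ofReal hz
  have hC0 : 0 ≤ C := abs_nonneg _
  set a := (⨆ y, ∫⁻ z, ‖z‖ₑ ^ p ∂(ζ y)) ^ (1 / p)
  have ha : a ≠ ∞ := ENNReal.rpow_ne_top_of_nonneg (by positivity) hζ.ne
  have hap : ∀ y, ∫⁻ z, ‖z‖ₑ ^ p ∂(ζ y) ≤ a ^ p := fun y => by
    rw [← ENNReal.rpow_mul, one_div, inv_mul_cancel₀ hp0.ne', ENNReal.rpow_one]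
    exact le_iSup (fun y => ∫⁻ z, ‖z‖ₑ ^ p ∂(ζ y)) y
  set e : ℕ → ℝ := fun n => M.γ ^ n * E
  have he0 : ∀ n, 0 ≤ e n := fun n => mul_nonneg (pow_nonneg M.γ_pos.le n) hE0
  set s : ℕ → ℝ := fun n => Real.exp (-(2 * e n / τ))
  have hs1 : ∀ n, 0 ≤ 1 - s n := fun n => by
    have : s n ≤ 1 := Real.exp_le_one_iff.2 (neg_nonpos.2 (by have := he0 n; positivity))
    linarith
  set b : ℕ → ℝ := fun n => (1 - s n) ^ (1 / p)
  have hb0 : ∀ n, 0 ≤ b n := fun n => Real.rpow_nonneg (hs1 n) _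
  -- The cost of the independent coupling starts the recursion; each step is the bound of
  -- `hasCoupling_softDistBellman` with `t = 1 - s n` and penalty bound `k + 2 * e n`.
  set D : ℕ → ℝ := fun n => Nat.rec (a.toReal + C)
    (fun n d => M.γ * (d + b n * (d + 2 * C)) + M.γ * (k + 2 * e n)) n
  have hDs : ∀ n, D (n + 1) = M.γ * (D n + b n * (D n + 2 * C)) + M.γ * (k + 2 * e n) :=
    fun n => rfl
  have hD0 : ∀ n, 0 ≤ D n := by
    intro n
    induction n with
    | zero => exact add_nonneg ENNReal.toReal_nonneg hC0
    | succ n ih =>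
      rw [hDs]
      have := he0 n
      have := hb0 n
      have := M.γ_pos
      positivity
  have hcoup : ∀ n, HasCoupling p ((softDistBellmanOpt M πref τ)^[n] ζ)
      (returnDist M (piStar M πref τ)) (ENNReal.ofReal (D n)) := by
    intro n
    induction n with
    | zero =>
      have e0 : ENNReal.ofReal (D 0) = a + ENNReal.ofReal C := by
        change ENNReal.ofReal (a.toReal + C) = _
        rw [ENNReal.ofReal_add ENNReal.toReal_nonneg hC0, ENNReal.ofReal_toReal ha]
      rw [e0]
      exact hasCoupling_prod (κ := ζ) hp hap fun y => lintegral_enorm_rpow_le_of_ae hp (hCae y)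
    | succ n ih =>
      have hg := hgood.iterate M πref hτ n
      have hgM := hg.1
      have hq := hg.isBddMeas
      have hBM := isMarkovKernel_boltzmann πref hq hτ
      obtain ⟨Q, R', hQF, hRF, hmix, hQ⟩ := exists_boltzmann_mixture πref hq hs hτ (hE n)
      have hst : ENNReal.ofReal (s n) + ENNReal.ofReal (1 - s n) = 1 := by
        rw [← ENNReal.ofReal_add (Real.exp_pos _).le (hs1 n), add_sub_cancel, ENNReal.ofReal_one]
      have := hasCoupling_softDistBellman M πref hτ.le hp (π' := piStar M πref τ) hmix hst hQ
        (measurable_klFn_boltzmann πref hq hτ)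
        (mul_klFn_boltzmann_le_of_approx M πref hτ hk hq (hE n)) ih hCe
      rw [Function.iterate_succ_apply', hDs, softDistBellmanOpt]
      convert this using 1
      have hDn := hD0 n
      have hbn := hb0 n
      have hen := he0 n
      have hγ := M.γ_pos
      rw [ENNReal.ofReal_add (by positivity) (by positivity), ENNReal.ofReal_mul hγ.le,
        ENNReal.ofReal_add hDn (by positivity), ENNReal.ofReal_mul hbn,
        ENNReal.ofReal_add hDn (by positivity), ENNReal.ofReal_mul zero_le_two,
        ENNReal.ofReal_rpow_of_nonneg (hs1 n) (by positivity), ENNReal.ofReal_ofNat]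
  have hel : Tendsto e atTop (𝓝 0) := by
    simpa using (tendsto_pow_atTop_nhds_zero_of_lt_one M.γ_pos.le M.γ_lt_one).mul_const E
  have hbl : Tendsto b atTop (𝓝 0) := by
    have h1 : Tendsto (fun n => 1 - s n) atTop (𝓝 0) := by
      have h2 : Tendsto (fun n => -(2 * e n / τ)) atTop (𝓝 0) := by
        simpa using ((hel.const_mul 2).div_const τ).neg
      simpa using ((Real.continuous_exp.tendsto _).comp h2).const_sub 1
    have := h1.rpow_const (p := 1 / p) (Or.inr (by positivity))
    rwa [Real.zero_rpow (by positivity)] at this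
  have hev : ∀ᶠ n in atTop, D n ≤ l := by
    -- Since `e n` and `b n` vanish, the coefficient of `D n` tends to `γ` and the additive term to
    -- `γ k`.
    refine eventually_le_of_perturbed_contraction M.γ_lt_one (g := M.γ * k)
      (b := fun n => M.γ * (1 + b n)) (h := fun n => M.γ * (b n * (2 * C) + (k + 2 * e n)))
      (fun n => mul_nonneg M.γ_pos.le (by linarith [hb0 n])) ?_ ?_
      (fun n => by rw [hDs]; exact le_of_eq (by ring)) hl
    · simpa using (hbl.const_add 1).const_mul M.γ
    · simpa using ((hbl.mul_const (2 * C)).add ((hel.const_mul 2).const_add k)).const_mul M.γ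
  filter_upwards [hev] with n hn
  obtain ⟨c, h1, h2, h3⟩ := hcoup n
  refine ⟨c, h1, h2, fun y => (h3 y).trans ?_⟩
  gcongr

end Iterates

end DERL

end

/-! ### Choice of the temperature and conclusion -/

theorem mainTheorem5 {S : Type*} {A : Type*}
    [MeasurableSpace S] [StandardBorelSpace S] [MeasurableSpace A] [StandardBorelSpace A]
    (M : DERL.MDP S A) (πref : Kernel S A) [IsMarkovKernel πref]
    (hcov : DERL.Coverage M πref)
    (p p' : ℝ) (hp : 1 ≤ p) (hp' : 1 ≤ p')
    (ω : Measure (S × A)) [IsProbabilityMeasure ω]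
    (ε δ : ℝ) (hε : 0 < ε) (hδ : 0 < δ) :
    ∃ τ : ℝ, 0 < τ ∧
      DERL.muWass p p' ω
          (DERL.softReturnDist M πref τ (DERL.piStar M πref τ))
          (DERL.returnDist M (DERL.piStar M πref τ)) ≤ ENNReal.ofReal (δ / 2) ∧
      DERL.IsRefOptimal M πref (ε / 2) (DERL.piStar M πref τ) ∧
      ∀ ζ : Kernel (S × A) ℝ, IsMarkovKernel ζ → DERL.HasBoundedMoments p ζ →
        ∃ N : ℕ, ∀ n, N ≤ n →
          DERL.muWass p p' ω (DERL.controlIter M πref τ ζ n)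
              (DERL.returnDist M (DERL.piStar M πref τ)) ≤ ENNReal.ofReal δ ∧
          DERL.IsRefOptimal M πref ε
            (DERL.boltzmann πref τ (DERL.meanQ (DERL.controlIter M πref τ ζ n))) := by
  open DERL Filter Topology in
  obtain ⟨L, hL0, hL⟩ := hcov.exists_essSup_le
  have hγ := M.γ_pos
  have hγ1 : 0 < 1 - M.γ := by linarith [M.γ_lt_one]
  have hmin : 0 < min δ ε := lt_min hδ hε
  obtain ⟨τ, hτ, hτle⟩ : ∃ τ : ℝ, 0 < τ ∧ M.γ * (τ * L) / (1 - M.γ) ≤ min δ ε / 2 := by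
    -- Dividing by `L + 1` instead of `L` covers `L = 0`.
    refine ⟨(1 - M.γ) * (min δ ε / 2) / (L + 1), by positivity, ?_⟩
    rw [div_le_iff₀ hγ1]
    have h1 : (1 - M.γ) * (min δ ε / 2) / (L + 1) * L ≤ (1 - M.γ) * (min δ ε / 2) := by
      rw [div_mul_eq_mul_div, div_le_iff₀ (by positivity)]
      exact mul_le_mul_of_nonneg_left (by linarith) (by positivity)
    calc _ ≤ 1 * ((1 - M.γ) * (min δ ε / 2)) :=
          mul_le_mul M.γ_lt_one.le h1 (by positivity) zero_le_one
      _ = _ := by ring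
  have hk := hL τ hτ
  have hτδ : M.γ * (τ * L) / (1 - M.γ) ≤ δ / 2 :=
    hτle.trans (by linarith [min_le_left δ ε])
  have hτε : M.γ * (τ * L) / (1 - M.γ) ≤ ε / 2 :=
    hτle.trans (by linarith [min_le_right δ ε])
  obtain ⟨hs, -⟩ := qSoftStar_spec M πref hτ
  have hπM : IsMarkovKernel (piStar M πref τ) := isMarkovKernel_boltzmann πref hs hτ
  -- The approximation lemmas with error `0` give the statements about `π^{τ,*}` itself.
  have hself : ∀ y, |qSoftStar M πref τ y - qSoftStar M πref τ y| ≤ 0 := by simp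
  have href : ∀ y, qRefStar M πref y - ε / 2 ≤ qSoftStar M πref τ y := fun y => by
    linarith [qRefStar_sub_le_qSoftStar M πref hτ hk y]
  refine ⟨τ, hτ, ?_, ⟨hπM, fun y => ?_⟩, fun ζ hζM hζ => ?_⟩
  · refine (muWass_le_of_forall hp' fun y => wass_softReturnDist_le M πref hp hτ
      (π := piStar M πref τ) (measurable_klFn_boltzmann πref hs hτ) (fun x => ?_) y).trans
      (ENNReal.ofReal_le_ofReal hτδ)
    have := mul_klFn_boltzmann_le_of_approx M πref hτ hk hs hself x
    rwa [mul_zero, add_zero] at this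
  · have := qSoftStar_sub_le_qValue M πref hτ hs hself y
    simp only [mul_zero, zero_div, sub_zero] at this
    exact (href y).trans this
  · have hgood := bddMean_of_hasBoundedMoments hp hζ
    obtain ⟨E, hE0, hE⟩ := exists_meanQ_iterate_abs_sub_le M πref hτ hgood
    -- The asymptotic level is at most `δ / 2`, strictly below `δ`; this slack makes a finite `N`
    -- possible.
    have hc := exists_hasCoupling_iterate M πref hτ hp (mul_nonneg hτ.le hL0) hk hζ
      (l := δ) (by linarith)
    have hlim : Tendsto (fun n : ℕ => M.γ * (2 * (M.γ ^ n * E)) / (1 - M.γ)) atTop (𝓝 0) := by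
      simpa using ((((tendsto_pow_atTop_nhds_zero_of_lt_one hγ.le M.γ_lt_one).mul_const
        E).const_mul 2).const_mul M.γ).div_const (1 - M.γ)
    -- Half of `ε` is spent on `q*_ref - q*_τ`; the other half absorbs the error of the current
    -- mean.
    obtain ⟨N, hN⟩ := eventually_atTop.1
      (hc.and (hlim.eventually (Iio_mem_nhds (half_pos hε))))
    refine ⟨N, fun n hn => ?_⟩
    obtain ⟨h1, h2⟩ := hN (n + 1) (by omega)
    rw [controlIter_eq_iterate]
    have hq := (hgood.iterate M πref hτ (n + 1)).isBddMeas
    refine ⟨muWass_le_of_forall hp' fun y => h1.wass_le hp y,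
      isMarkovKernel_boltzmann πref hq hτ, fun y => ?_⟩
    have h3 := qSoftStar_sub_le_qValue M πref hτ hq (hE (n + 1)) y
    have h4 := href y
    have h5 : _ < ε / 2 := h2
    linarith
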